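/- For positive integers $n,k$ write $[n]=\{1,\dots,n\}$ and let $\binom{[n]}{k}$ be the set of all $k$-element subsets of $[n]$. The Kneser graph $K(n,k)$ has vertex set $\binom{[n]}{k}$, two $k$-sets being adjacent iff they are disjoint. For $\mathcal F\subseteq\binom{[n]}{k}$ let $\Delta(\mathcal F)$ denote the maximum degree of the subgraph of $K(n,k)$ induced by $\mathcal F$, and for $I\subseteq J\subseteq[n]$ put $\mathcal F^I_J=\{A\setminus J: A\in\mathcal F,\ A\cap J=I\}$. A star is a family $\{A\in\binom{[n]}{k}: i\in A\}$ with $i\in[n]$. For an integer $s\ge 1$ and a real number $\lambda\in[s,s+1]$, the family $\mathcal F$ has size parameter $\lambda$ if $$|\mathcal F|=\binom nk-\binom{n-s}{k}+(\lambda-s)\binom{n-s-1}{k-1}.$$ Lemma. Let $n,k,s$ be positive integers with $n\ge 100s^2k$, put $p=k/n$, and let $\lambda\in[s,s+1]$ be real. Suppose that $\mathcal F\subseteq\binom{[n]}{k}$ has size parameter $\lambda$, is not a union of $s$ distinct stars, and minimizes the maximum degree subject to these conditions, i.e. $\Delta(\mathcal F)\le\Delta(\mathcal G)$ for every $\mathcal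 G\subseteq\binom{[n]}{k}$ that has size parameter $\lambda$ and is not a union of $s$ distinct stars. Then there are at least $s+1$ elements $x\in[n]$ such that $$\left|\mathcal F^{\{x\}}_{\{x\}}\right|\ \ge\ \binom{n-1}{k-1}\left(\frac{\lambda}{s+1}-\sqrt{40(s+1)p}-(s^2+4s)p\right).$$ -/

import Mathlib

open Finset

/-- `KSet n k` is the set of all `k`-element subsets of an `n`-element ground set. -/
abbrev KSet (n k : ℕ) : Type := {A : Finset (Fin n) // A.card = k}

/-- The Kneser graph `K(n, k)`: two (distinct) `k`-sets are adjacent iff they are disjoint.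
The condition `A ≠ B` matters only for `k = 0`, where it prevents a loop. -/
def kneserGraph (n k : ℕ) : SimpleGraph (KSet n k) where
  Adj A B := A ≠ B ∧ Disjoint A.1 B.1
  symm := ⟨fun _ _ h => ⟨h.1.symm, h.2.symm⟩⟩
  loopless := ⟨fun _ h => h.1 rfl⟩

open Classical in
/-- The maximum degree of the subgraph of `K(n, k)` induced by the family `F`. -/
noncomputable def familyMaxDegree {n k : ℕ} (F : Finset (KSet n k)) : ℕ :=
  ((kneserGraph n k).induce (F : Set (KSet n k))).maxDegree

/-- The star with centre `i`: all `k`-sets containing `i`. -/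
def kStar (n k : ℕ) (i : Fin n) : Finset (KSet n k) :=
  Finset.univ.filter (fun A => i ∈ A.1)

/-- `F` is the union of `s` (distinct) stars. -/
def IsUnionOfStars {n k : ℕ} (s : ℕ) (F : Finset (KSet n k)) : Prop :=
  ∃ S : Finset (Fin n), S.card = s ∧ F = S.biUnion (kStar n k)

/-- `F` has size parameter `lam`, where `s ≤ lam ≤ s + 1`. -/
def HasSizeParameter {n k : ℕ} (s : ℕ) (lam : ℝ) (F : Finset (KSet n k)) : Prop :=
  (s : ℝ) ≤ lam ∧ lam ≤ (s : ℝ) + 1 ∧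
    (F.card : ℝ) = (n.choose k : ℝ) - ((n - s).choose k : ℝ)
      + (lam - s) * ((n - s - 1).choose (k - 1) : ℝ)

/-- The family `F^I_J = {A \ J : A ∈ F, A ∩ J = I}`. -/
def familyTrace {n k : ℕ} (F : Finset (KSet n k)) (I J : Finset (Fin n)) : Finset (Finset (Fin n)) :=
  (F.filter (fun A => A.1 ∩ J = I)).image (fun A => A.1 \ J)

/-! Write p = k/n, N = C(n-1,k-1), L = C(n-k-1,k-1), and let τ be the bracket in the claimed bound.
If fewer than s+1 points have degree at least Nτ, then two estimates of Δ(F) contradict each other.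

Lower bound. Choose T of size s containing every heavy point. Let H be the part of F avoiding T, and
let M be the sets that hit T but are missing from F. The size condition gives |H| - |M| =
(λ-s)C(n-s-1,k-1) ≥ 0, and H is nonempty because F is not a union of s stars. A member of H has
about sL neighbours among all sets hitting T, so its degree in F is this number, plus its degree
into H, minus its degree into M. These are averaged over H using 1_H = constant + linear part +
rest. The constant parts contribute about (λ-s)L. The linear part is an eigenvector of the Kneser
operator with eigenvalue -L; its norm is at most about τ|H| because every point has degree at most
Nτ in H, and its sum over M is small because M is covered by T, where H has degree zero. On the rest
the Kneser operator has norm at most C(n-k-2,k-2), which is O(p)L. Hence Δ(F) ≥ L(λ - τ -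
O(√((s+1)p))), up to terms of order s²p.

Upper bound. Take s+1 centres and keep, from each of their stars, only the sets that contain another
point of a fixed set Y. A member hits some centre, so its neighbours lie in at most s of the stars.
When Y is chosen to give the correct size, each star retains a fraction about λ/(s+1), so Δ(F) ≤
L(sλ/(s+1) + O(sp)) by minimality.

Since λ - sλ/(s+1) = λ/(s+1), comparing the two bounds forces τ above the value it was assigned. The
carrying lemmas are `normSqLayer_kneserSum_le`, `levelOneMass_le`, `abs_sum_levelOne_le`,
`maxDegree_lower_bound`, `exists_family_small_maxDegree` and `choose_ratio_comparison`. The case k =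
1 is separate and elementary. -/

section Spectral

/-! ### Up and down operators on the Boolean lattice, and the Kneser operator above level one. -/

variable {α : Type*} [DecidableEq α]

/-- The up operator: sum of `g` over the facets of `A`. -/
noncomputable def upSum (g : Finset α → ℝ) (A : Finset α) : ℝ :=
  ∑ x ∈ A, g (A.erase x)

/-- The `m`-fold up operator is `m!` times the sum over subsets of codimension `m`. -/
theorem iterate_upSum (m : ℕ) (f : Finset α → ℝ) (C : Finset α) (j : ℕ) (hC : C.card = j + m) :
    upSum^[m] f C = (m.factorial : ℝ) * ∑ B ∈ C.powersetCard j, f B := by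
  induction m generalizing C with
  | zero =>
    have : C.powersetCard j = {C} := by
      rw [← powersetCard_self C, hC]; simp
    simp [this]
  | succ m ih =>
    rw [Function.iterate_succ_apply', upSum]
    have h1 : ∀ x ∈ C, upSum^[m] f (C.erase x)
        = (m.factorial : ℝ) * ∑ B ∈ C.powersetCard j, if x ∉ B then f B else 0 := by
      intro x hx
      rw [ih (C.erase x) (by rw [card_erase_of_mem hx]; omega), ← sum_filter]
      congr 2
      ext B
      simp only [mem_powersetCard, mem_filter, subset_erase]
      tauto
    rw [sum_congr rfl h1, ← mul_sum, sum_comm, Nat.factorial_succ]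
    have h2 : ∀ B ∈ C.powersetCard j, (∑ x ∈ C, if x ∉ B then f B else 0)
        = ((m + 1 : ℕ) : ℝ) * f B := by
      intro B hB
      rw [mem_powersetCard] at hB
      rw [← sum_filter, sum_const, nsmul_eq_mul, filter_notMem_eq_sdiff,
        card_sdiff_of_subset hB.1, hC, hB.2]
      congr 2
      omega
    rw [sum_congr rfl h2, ← mul_sum]
    push_cast
    ring

variable [Fintype α]

/-- The down operator: sum of `f` over the covers of `S`. -/
noncomputable def downSum (f : Finset α → ℝ) (S : Finset α) : ℝ :=
  ∑ x ∈ Sᶜ, f (insert x S)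

/-- The `j`-element sets, as a finset. -/
abbrev layer (α : Type*) [Fintype α] (j : ℕ) : Finset (Finset α) :=
  powersetCard j (univ : Finset α)

omit [DecidableEq α] in
theorem mem_layer {j : ℕ} {A : Finset α} : A ∈ layer α j ↔ A.card = j := by
  simp [layer, mem_powersetCard]

theorem sum_layer_succ (j : ℕ) (φ : Finset α → α → ℝ) :
    ∑ A ∈ layer α (j + 1), ∑ x ∈ A, φ A x = ∑ S ∈ layer α j, ∑ x ∈ Sᶜ, φ (insert x S) x := by
  rw [sum_sigma', sum_sigma']
  refine sum_bij' (fun a _ => ⟨a.1.erase a.2, a.2⟩) (fun a _ => ⟨insert a.2 a.1, a.2⟩)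
    ?_ ?_ ?_ ?_ ?_
  · rintro ⟨A, x⟩ h
    simp only [mem_sigma, mem_layer] at h
    simp [card_erase_of_mem h.2, h.1]
  · rintro ⟨S, x⟩ h
    simp only [mem_sigma, mem_layer, mem_compl] at h
    simp [card_insert_of_notMem h.2, h.1]
  · rintro ⟨A, x⟩ h
    simp only [mem_sigma] at h
    simp [insert_erase h.2]
  · rintro ⟨S, x⟩ h
    simp only [mem_sigma, mem_compl] at h
    simp [erase_insert h.2]
  · rintro ⟨A, x⟩ h
    simp only [mem_sigma] at h
    simp [insert_erase h.2]

/-- Up and down are adjoint: both sides sum over pairs consisting of a (j+1)-set and one of its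
facets. -/
theorem sum_mul_upSum (j : ℕ) (f g : Finset α → ℝ) :
    ∑ A ∈ layer α (j + 1), f A * upSum g A = ∑ S ∈ layer α j, downSum f S * g S := by
  simp only [upSum, downSum, mul_sum, sum_mul]
  rw [sum_layer_succ]
  refine sum_congr rfl fun S _ => sum_congr rfl fun x hx => ?_
  rw [erase_insert (by simpa using hx)]

/-- In either order the moves that exchange an element of S for one outside it agree. The moves that
return to S number n - |S| in one order and |S| in the other. -/
theorem downSum_upSum (g : Finset α → ℝ) (S : Finset α) :
    downSum (upSum g) S
      = upSum (downSum g) S + ((Fintype.card α : ℝ) - 2 * S.card) * g S := by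
  have h1 : downSum (upSum g) S
      = ∑ x ∈ Sᶜ, (g S + ∑ y ∈ S, g (insert x (S.erase y))) := by
    refine sum_congr rfl fun x hx => ?_
    have hx' : x ∉ S := by simpa using hx
    rw [upSum, sum_insert hx', erase_insert hx']
    congr 1
    refine sum_congr rfl fun y hy => ?_
    rw [erase_insert_of_ne (by rintro rfl; exact hx' hy)]
  have h2 : upSum (downSum g) S
      = ∑ y ∈ S, (g S + ∑ x ∈ Sᶜ, g (insert x (S.erase y))) := by
    refine sum_congr rfl fun y hy => ?_
    rw [downSum, compl_erase, sum_insert (by simpa using hy), insert_erase hy]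
  rw [h1, h2, sum_add_distrib, sum_add_distrib, sum_comm, sum_const, sum_const, card_compl,
    nsmul_eq_mul, nsmul_eq_mul, Nat.cast_sub (card_le_univ S)]
  ring

/-- `f` sums to zero over the `j`-sets through each point. -/
def PointSumZero (j : ℕ) (f : Finset α → ℝ) : Prop :=
  ∀ x : α, ∑ A ∈ layer α j, f A * (if x ∈ A then 1 else 0) = 0

theorem PointSumZero.layer_sum {j : ℕ} {f : Finset α → ℝ} (hf : PointSumZero (j + 1) f) :
    ∑ A ∈ layer α (j + 1), f A = 0 := by
  have h : ∑ x : α, ∑ A ∈ layer α (j + 1), f A * (if x ∈ A then (1 : ℝ) else 0) = 0 :=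
    sum_eq_zero fun x _ => hf x
  rw [sum_comm] at h
  have h2 : ∀ A ∈ layer α (j + 1), ∑ x : α, f A * (if x ∈ A then (1 : ℝ) else 0)
      = f A * (j + 1 : ℝ) := by
    intro A hA
    rw [mem_layer] at hA
    rw [← mul_sum]
    simp [hA]
  rw [sum_congr rfl h2, ← sum_mul] at h
  rcases mul_eq_zero.mp h with h | h
  · exact h
  · exact absurd h (by positivity)

/-- By adjointness it suffices to lift the indicator of x ∈ B. On (j+1)-sets its lift is j times the
same indicator, since deleting any of the j other elements keeps x. -/
theorem PointSumZero.down {j : ℕ} {f : Finset α → ℝ} (hf : PointSumZero (j + 1) f) :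
    PointSumZero j (downSum f) := by
  intro x
  rw [← sum_mul_upSum]
  have h : ∀ A ∈ layer α (j + 1), f A * upSum (fun B => if x ∈ B then (1 : ℝ) else 0) A
      = j * (f A * if x ∈ A then 1 else 0) := by
    intro A hA
    rw [mem_layer] at hA
    by_cases hx : x ∈ A
    · simp only [upSum, mem_erase, hx, and_true, if_true]
      rw [← sum_filter_add_sum_filter_not A (fun y => y = x), filter_eq' A x]
      simp only [hx, if_true, sum_singleton, ne_eq, not_true_eq_false, if_false, zero_add]
      rw [filter_ne' A x]
      have : ∀ y ∈ A.erase x, (if ¬ x = y then (1 : ℝ) else 0) = 1 := by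
        intro y hy
        rw [if_pos]
        exact fun h => (ne_of_mem_erase hy) h.symm
      rw [sum_congr rfl this, sum_const, card_erase_of_mem hx, hA]
      simp
      ring
    · simp [upSum, hx]
  rw [sum_congr rfl h, ← mul_sum, hf x, mul_zero]

/-- By adjointness, the indicator of x ∈ A is pushed down. The result is a combination of that
indicator and a constant, and g is orthogonal to both. -/
theorem PointSumZero.up {j : ℕ} {g : Finset α → ℝ} (hg : PointSumZero (j + 1) g) :
    PointSumZero (j + 2) (upSum g) := by
  intro x
  have h0 : ∑ A ∈ layer α (j + 2), upSum g A * (if x ∈ A then (1 : ℝ) else 0)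
      = ∑ A ∈ layer α (j + 2), (if x ∈ A then (1 : ℝ) else 0) * upSum g A :=
    sum_congr rfl fun A _ => mul_comm _ _
  rw [h0, sum_mul_upSum (j + 1) (fun A => if x ∈ A then (1 : ℝ) else 0)]
  have h : ∀ S ∈ layer α (j + 1), downSum (fun A => if x ∈ A then (1 : ℝ) else 0) S * g S
      = ((Fintype.card α : ℝ) - (j + 1) - 1) * (g S * if x ∈ S then 1 else 0) + g S := by
    intro S hS
    rw [mem_layer] at hS
    by_cases hx : x ∈ S
    · simp only [downSum, mem_insert, hx, or_true, if_true, sum_const, card_compl,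
        nsmul_eq_mul]
      rw [Nat.cast_sub (card_le_univ S), hS]
      push_cast
      ring
    · simp [downSum, hx, mem_insert]
  rw [sum_congr rfl h, sum_add_distrib, ← mul_sum, hg x, hg.layer_sum]
  simp

/-- The squared norm of `f` on the `j`-sets. -/
noncomputable def normSqLayer (j : ℕ) (f : Finset α → ℝ) : ℝ := ∑ A ∈ layer α j, f A ^ 2

omit [DecidableEq α] in
theorem normSqLayer_nonneg (j : ℕ) (f : Finset α → ℝ) : 0 ≤ normSqLayer j f :=
  sum_nonneg fun _ _ => sq_nonneg _

theorem normSqLayer_upSum_eq (j : ℕ) (g : Finset α → ℝ) :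
    normSqLayer (j + 2) (upSum g)
      = normSqLayer j (downSum g) + ((Fintype.card α : ℝ) - 2 * (j + 1)) * normSqLayer (j + 1) g := by
  have h1 : normSqLayer (j + 2) (upSum g) = ∑ A ∈ layer α (j + 2), upSum g A * upSum g A :=
    sum_congr rfl fun _ _ => sq _
  have h2 : normSqLayer j (downSum g) = ∑ S ∈ layer α j, downSum g S * downSum g S :=
    sum_congr rfl fun _ _ => sq _
  rw [h1, h2, sum_mul_upSum (j + 1), ← sum_mul_upSum j, normSqLayer, mul_sum, ← sum_add_distrib]
  refine sum_congr rfl fun S hS => ?_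
  rw [mem_layer] at hS
  rw [downSum_upSum, hS]
  push_cast
  ring

/-- With D = `downSum` and U = `upSum`, the constant is the largest eigenvalue of UD on functions
orthogonal to levels zero and one, obtained here without diagonalising. Induction bounds ‖UDf‖² by
e‖Df‖², and Cauchy–Schwarz in ‖Df‖² = ⟨f, UDf⟩ lets one factor ‖Df‖² cancel. In the base case Df on
singletons is itself a point sum, hence zero. -/
theorem normSqLayer_downSum_le (i : ℕ) (hi : i + 3 ≤ Fintype.card α) (f : Finset α → ℝ)
    (hf : PointSumZero (i + 2) f) :
    normSqLayer (i + 1) (downSum f)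
      ≤ (i * ((Fintype.card α : ℝ) - i - 3)) * normSqLayer (i + 2) f := by
  induction i generalizing f with
  | zero =>
    have : normSqLayer 1 (downSum f) = 0 := by
      refine sum_eq_zero fun S hS => ?_
      rw [mem_layer, card_eq_one] at hS
      obtain ⟨x, rfl⟩ := hS
      rw [sq_eq_zero_iff, ← hf.down x]
      rw [sum_eq_single {x}]
      · simp
      · intro S hS hne
        rw [mem_layer, card_eq_one] at hS
        obtain ⟨y, rfl⟩ := hS
        have : x ≠ y := by rintro rfl; exact hne rfl
        simp [this]
      · intro h
        exact absurd (mem_layer.mpr (card_singleton x)) h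
    simp [this]
  | succ i ih =>
    set e : ℝ := ((i + 1 : ℕ) : ℝ) * ((Fintype.card α : ℝ) - (i + 1 : ℕ) - 3) with he
    have hcard : ((i + 4 : ℕ) : ℝ) ≤ Fintype.card α := by exact_mod_cast hi
    have he0 : 0 ≤ e := by
      push_cast at hcard
      refine mul_nonneg (by positivity) ?_
      push_cast
      linarith
    have hup : normSqLayer (i + 3) (upSum (downSum f)) ≤ e * normSqLayer (i + 2) (downSum f) := by
      rw [normSqLayer_upSum_eq (i + 1)]
      have := ih (by omega) (downSum f) hf.down
      -- The eigenvalue bounds at consecutive levels differ by exactly the commutator constant.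
      have h3 : e = i * ((Fintype.card α : ℝ) - i - 3)
          + ((Fintype.card α : ℝ) - 2 * (((i + 1 : ℕ) : ℝ) + 1)) := by
        rw [he]; push_cast; ring
      rw [h3, add_mul]
      linarith
    have hcs : normSqLayer (i + 2) (downSum f) ^ 2
        ≤ normSqLayer (i + 3) f * normSqLayer (i + 3) (upSum (downSum f)) := by
      have h1 : normSqLayer (i + 2) (downSum f)
          = ∑ A ∈ layer α (i + 3), f A * upSum (downSum f) A := by
        rw [sum_mul_upSum]
        exact sum_congr rfl fun _ _ => sq _
      rw [h1]
      exact sum_mul_sq_le_sq_mul_sq _ _ _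
    have h0 := normSqLayer_nonneg (i + 2) (downSum f)
    have h1 := normSqLayer_nonneg (i + 3) f
    change normSqLayer (i + 2) (downSum f) ≤ e * normSqLayer (i + 3) f
    rcases h0.eq_or_lt with h | h
    · rw [← h]; positivity
    · have h2 := hcs.trans (mul_le_mul_of_nonneg_left hup h1)
      have h3 : normSqLayer (i + 2) (downSum f) * normSqLayer (i + 2) (downSum f)
          ≤ (e * normSqLayer (i + 3) f) * normSqLayer (i + 2) (downSum f) := by
        nlinarith
      exact le_of_mul_le_mul_right h3 h

theorem normSqLayer_upSum_le (i : ℕ) (hi : i + 3 ≤ Fintype.card α) (g : Finset α → ℝ)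
    (hg : PointSumZero (i + 2) g) :
    normSqLayer (i + 3) (upSum g)
      ≤ ((i + 1) * ((Fintype.card α : ℝ) - i - 4)) * normSqLayer (i + 2) g := by
  rw [normSqLayer_upSum_eq (i + 1)]
  have := normSqLayer_downSum_le i hi g hg
  have h3 : ((i : ℝ) + 1) * ((Fintype.card α : ℝ) - i - 4) = i * ((Fintype.card α : ℝ) - i - 3)
      + ((Fintype.card α : ℝ) - 2 * (((i + 1 : ℕ) : ℝ) + 1)) := by
    push_cast; ring
  rw [h3, add_mul]
  linarith

theorem PointSumZero.iterate_up {i : ℕ} {f : Finset α → ℝ} (hf : PointSumZero (i + 2) f)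
    (t : ℕ) : PointSumZero (i + t + 2) (upSum^[t] f) := by
  induction t with
  | zero => exact hf
  | succ t ih =>
    rw [Function.iterate_succ_apply']
    exact ih.up

/-- Multiplying the one-step bounds: with n = 2i+4+m the step from level i+t+2 contributes
(i+t+1)(i+m-t), so the two factors build up a rising and a falling factorial. -/
theorem normSqLayer_iterate_upSum_le (i m : ℕ) (hn : Fintype.card α = 2 * i + 4 + m)
    (f : Finset α → ℝ) (hf : PointSumZero (i + 2) f) (t : ℕ) (ht : t ≤ m) :
    normSqLayer (i + t + 2) (upSum^[t] f)
      ≤ (((i + 1).ascFactorial t : ℝ) * ((i + m).descFactorial t : ℝ)) * normSqLayer (i + 2) f := by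
  induction t with
  | zero => simp
  | succ t ih =>
    rw [Function.iterate_succ_apply']
    have h1 := normSqLayer_upSum_le (i + t) (by omega) _ (hf.iterate_up t)
    have h2 := ih (by omega)
    rw [Nat.ascFactorial_succ, Nat.descFactorial_succ]
    have h3 : ((i + m - t : ℕ) : ℝ) = (Fintype.card α : ℝ) - ((i + t : ℕ) : ℝ) - 4 := by
      rw [Nat.cast_sub (by omega), hn]; push_cast; ring
    have h4 : (0 : ℝ) ≤ (((i + t : ℕ) : ℝ) + 1) * ((Fintype.card α : ℝ) - ((i + t : ℕ) : ℝ) - 4) := by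
      rw [← h3]; positivity
    refine h1.trans ((mul_le_mul_of_nonneg_left h2 h4).trans (le_of_eq ?_))
    rw [Nat.cast_mul, Nat.cast_mul, h3]
    push_cast
    ring

/-- The Kneser operator: sum of `f` over the `k`-sets disjoint from `A`. -/
noncomputable def kneserSum (k : ℕ) (f : Finset α → ℝ) (A : Finset α) : ℝ :=
  ∑ B ∈ powersetCard k Aᶜ, f B

/-- On functions with vanishing point sums, the Kneser operator has norm at most
`(n - k - 2).choose (k - 2)`. -/
theorem normSqLayer_kneserSum_le (k : ℕ) (hk : 2 ≤ k) (hn : 2 * k ≤ Fintype.card α)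
    (f : Finset α → ℝ) (hf : PointSumZero k f) :
    normSqLayer k (kneserSum k f)
      ≤ ((Fintype.card α - k - 2).choose (k - 2) : ℝ) ^ 2 * normSqLayer k f := by
  obtain ⟨i, rfl⟩ := Nat.exists_eq_add_of_le' hk
  obtain ⟨m, hm⟩ := Nat.exists_eq_add_of_le hn
  have h1 := normSqLayer_iterate_upSum_le i m (by omega) f hf m le_rfl
  -- The k-sets disjoint from A are the k-subsets of its complement. With m = n - 2k, the m-fold up
  -- operator at the complement of A is therefore m! times the Kneser sum at A.
  have h2 : normSqLayer (i + m + 2) (upSum^[m] f)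
      = (m.factorial : ℝ) ^ 2 * normSqLayer (i + 2) (kneserSum (i + 2) f) := by
    rw [normSqLayer, normSqLayer, mul_sum]
    refine sum_bij' (fun A _ => Aᶜ) (fun A _ => Aᶜ) ?_ ?_ ?_ ?_ ?_
    · intro A hA
      rw [mem_layer] at hA ⊢
      rw [card_compl]; omega
    · intro A hA
      rw [mem_layer] at hA ⊢
      rw [card_compl]; omega
    · intro A _; exact compl_compl A
    · intro A _; exact compl_compl A
    · intro A hA
      rw [mem_layer] at hA
      rw [iterate_upSum m f A (i + 2) (by omega), kneserSum, compl_compl, mul_pow]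
  -- Both products equal m! times the same binomial coefficient, so the factor (m!)² cancels.
  have h3 : (((i + 1).ascFactorial m : ℝ) * ((i + m).descFactorial m : ℝ))
      = (m.factorial : ℝ) ^ 2 * ((i + m).choose i : ℝ) ^ 2 := by
    have ha : (i + 1).ascFactorial m = m.factorial * (i + m).choose i := by
      rw [Nat.ascFactorial_eq_factorial_mul_choose, Nat.choose_symm_add]
    have hd : (i + m).descFactorial m = m.factorial * (i + m).choose i := by
      rw [Nat.descFactorial_eq_factorial_mul_choose, Nat.choose_symm_add]
    rw [ha, hd]; push_cast; ring
  rw [h2, h3, mul_assoc] at h1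
  have h4 : (0 : ℝ) < (m.factorial : ℝ) ^ 2 := by positivity
  have h5 := le_of_mul_le_mul_left h1 h4
  have h6 : Fintype.card α - (i + 2) - 2 = i + m := by omega
  rw [h6]
  simpa using h5

end Spectral

/-! ### Linear functions on k-sets: eigenvalue and moments. -/

section LevelOne

variable {α : Type*} [Fintype α] [DecidableEq α]

/-- Complementation gives the lower index n - k. In this form the count vanishes correctly when S
has more than k elements, where a truncated k - |S| would give 1. -/
theorem card_layer_filter_superset (k : ℕ) (hk : k ≤ Fintype.card α) (S : Finset α) :
    ((layer α k).filter (fun A => S ⊆ A)).card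
      = (Fintype.card α - S.card).choose (Fintype.card α - k) := by
  rw [← card_compl, ← card_powersetCard]
  refine card_bij' (fun A _ => Aᶜ) (fun A _ => Aᶜ) ?_ ?_ ?_ ?_
  · intro A hA
    rw [mem_filter, mem_layer] at hA
    rw [mem_powersetCard, card_compl, hA.1]
    exact ⟨compl_subset_compl.mpr hA.2, rfl⟩
  · intro A hA
    rw [mem_powersetCard] at hA
    rw [mem_filter, mem_layer, card_compl, hA.2]
    exact ⟨by omega, by rw [← compl_compl S]; exact compl_subset_compl.mpr hA.1⟩
  · intro A _; exact compl_compl A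
  · intro A _; exact compl_compl A

/-- The number of `k`-sets containing a given `j`-set, as a real number. -/
noncomputable def coverCount (α : Type*) [Fintype α] (k j : ℕ) : ℝ :=
  ((Fintype.card α - j).choose (Fintype.card α - k) : ℝ)

omit [DecidableEq α] in
theorem coverCount_nonneg (k j : ℕ) : 0 ≤ coverCount α k j := Nat.cast_nonneg _

theorem sum_layer_superset (k : ℕ) (hk : k ≤ Fintype.card α) (S : Finset α) :
    ∑ A ∈ layer α k, (if S ⊆ A then (1 : ℝ) else 0) = coverCount α k S.card := by
  rw [← sum_filter, sum_const, card_layer_filter_superset k hk, coverCount]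
  simp

omit [Fintype α] in
theorem card_powersetCard_filter_mem (k : ℕ) (hk : 1 ≤ k) (S : Finset α) (x : α) (hx : x ∈ S) :
    ((S.powersetCard k).filter (fun B => x ∈ B)).card = (S.card - 1).choose (k - 1) := by
  rw [← card_erase_of_mem hx, ← card_powersetCard]
  refine card_bij' (fun A _ => A.erase x) (fun A _ => insert x A) ?_ ?_ ?_ ?_
  · intro A hA
    rw [mem_filter, mem_powersetCard] at hA
    rw [mem_powersetCard, card_erase_of_mem hA.2, hA.1.2]
    exact ⟨erase_subset_erase x hA.1.1, rfl⟩
  · intro A hA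
    rw [mem_powersetCard, subset_erase] at hA
    rw [mem_filter, mem_powersetCard, card_insert_of_notMem hA.1.2, hA.2]
    exact ⟨⟨insert_subset hx hA.1.1, by omega⟩, mem_insert_self _ _⟩
  · intro A hA
    rw [mem_filter] at hA
    exact insert_erase hA.2
  · intro A hA
    rw [mem_powersetCard, subset_erase] at hA
    exact erase_insert hA.1.2

omit [Fintype α] in
theorem sum_powersetCard_sum (k : ℕ) (hk : 1 ≤ k) (S : Finset α) (a : α → ℝ) :
    ∑ B ∈ S.powersetCard k, ∑ x ∈ B, a x
      = ((S.card - 1).choose (k - 1) : ℝ) * ∑ x ∈ S, a x := by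
  have h1 : ∀ B ∈ S.powersetCard k, ∑ x ∈ B, a x = ∑ x ∈ S, if x ∈ B then a x else 0 := by
    intro B hB
    rw [← sum_filter, filter_mem_eq_inter, inter_eq_right.mpr (mem_powersetCard.mp hB).1]
  rw [sum_congr rfl h1, sum_comm, mul_sum]
  refine sum_congr rfl fun x hx => ?_
  rw [← sum_filter, sum_const, card_powersetCard_filter_mem k hk S x hx, nsmul_eq_mul]

/-- As the coefficients have total zero, their sum over the complement of A is minus their sum over
A. Zero-sum linear functions are thus eigenvectors with eigenvalue -C(n-k-1,k-1). -/
theorem kneserSum_sum (k : ℕ) (hk : 1 ≤ k) (a : α → ℝ) (ha : ∑ x, a x = 0)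
    (A : Finset α) (hA : A.card = k) :
    kneserSum k (fun B => ∑ x ∈ B, a x) A
      = -((Fintype.card α - k - 1).choose (k - 1) : ℝ) * ∑ x ∈ A, a x := by
  rw [kneserSum, sum_powersetCard_sum k hk, card_compl, hA]
  have : ∑ x ∈ Aᶜ, a x = -∑ x ∈ A, a x := by
    rw [← sum_add_sum_compl A] at ha; linarith
  rw [this]; ring

theorem sum_eq_sum_univ_indicator (A : Finset α) (φ : α → ℝ) :
    ∑ x ∈ A, φ x = ∑ x, φ x * if x ∈ A then 1 else 0 := by
  simp

/-- A pair x, t is covered by c₂ sets if x ≠ t and by c₁ if x = t. The constant part c₂ is killed by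
the zero sum, leaving c₁ - c₂ on the diagonal. -/
theorem sum_layer_mem_mul_sum (k : ℕ) (hk : k ≤ Fintype.card α) (a : α → ℝ) (ha : ∑ x, a x = 0)
    (t : α) :
    ∑ A ∈ layer α k, (∑ x ∈ A, a x) * (if t ∈ A then 1 else 0)
      = (coverCount α k 1 - coverCount α k 2) * a t := by
  have h1 : ∀ A ∈ layer α k, (∑ x ∈ A, a x) * (if t ∈ A then (1 : ℝ) else 0)
      = ∑ x, a x * if ({x, t} : Finset α) ⊆ A then 1 else 0 := by
    intro A _
    rw [sum_eq_sum_univ_indicator, sum_mul]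
    refine sum_congr rfl fun x _ => ?_
    by_cases h1 : x ∈ A <;> by_cases h2 : t ∈ A <;> simp [h1, h2, insert_subset_iff]
  rw [sum_congr rfl h1, sum_comm]
  have h2 : ∀ x ∈ (univ : Finset α), ∑ A ∈ layer α k, a x * (if ({x, t} : Finset α) ⊆ A then (1 : ℝ) else 0)
      = a x * coverCount α k 2
        + (if x = t then a x * (coverCount α k 1 - coverCount α k 2) else 0) := by
    intro x _
    rw [← mul_sum, sum_layer_superset k hk]
    by_cases h : x = t
    · subst h; simp; ring
    · simp [h, card_pair h]
  rw [sum_congr rfl h2, sum_add_distrib, ← sum_mul, ha]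
  simp
  ring

theorem sum_layer_sum_eq_zero (k : ℕ) (hk : 1 ≤ k) (a : α → ℝ) (ha : ∑ x, a x = 0) :
    ∑ A ∈ layer α k, ∑ x ∈ A, a x = 0 := by
  rw [sum_powersetCard_sum k hk, ha, mul_zero]

theorem sum_layer_sum_mul_sum (k : ℕ) (hk : k ≤ Fintype.card α) (a b : α → ℝ)
    (ha : ∑ x, a x = 0) :
    ∑ A ∈ layer α k, (∑ x ∈ A, a x) * (∑ x ∈ A, b x)
      = (coverCount α k 1 - coverCount α k 2) * ∑ x, a x * b x := by
  have h1 : ∀ A ∈ layer α k, (∑ x ∈ A, a x) * (∑ x ∈ A, b x)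
      = ∑ t, b t * ((∑ x ∈ A, a x) * (if t ∈ A then 1 else 0)) := by
    intro A _
    rw [sum_eq_sum_univ_indicator A b, mul_sum]
    exact sum_congr rfl fun x _ => by ring
  rw [sum_congr rfl h1, sum_comm, mul_sum]
  refine sum_congr rfl fun t _ => ?_
  rw [← mul_sum, sum_layer_mem_mul_sum k hk a ha]
  ring

/-- The second moment on a single star. After the square is expanded, the number of sets covering x,
y, t depends only on which of the three coincide, and the zero sum removes most patterns. The exact
value is (c₂-c₃)∑a² + (c₁-3c₂+2c₃)a_t². -/
theorem sum_layer_mem_sum_sq_le (k : ℕ) (hk : k ≤ Fintype.card α) (a : α → ℝ)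
    (ha : ∑ x, a x = 0) (t : α) (h32 : coverCount α k 3 ≤ coverCount α k 2) :
    ∑ A ∈ layer α k, (∑ x ∈ A, a x) ^ 2 * (if t ∈ A then 1 else 0)
      ≤ coverCount α k 1 * a t ^ 2 + coverCount α k 2 * ∑ x, a x ^ 2 := by
  have h1 : ∀ A ∈ layer α k, (∑ x ∈ A, a x) ^ 2 * (if t ∈ A then (1 : ℝ) else 0)
      = ∑ x, ∑ y, a x * a y * if ({x, y, t} : Finset α) ⊆ A then 1 else 0 := by
    intro A _
    rw [sum_eq_sum_univ_indicator, sq, sum_mul_sum, sum_mul]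
    refine sum_congr rfl fun x _ => ?_
    rw [sum_mul]
    refine sum_congr rfl fun y _ => ?_
    by_cases h1 : x ∈ A <;> by_cases h2 : t ∈ A <;> by_cases h3 : y ∈ A <;>
      simp [h1, h2, h3, insert_subset_iff]
  have h2 : ∀ x y : α, coverCount α k ({x, y, t} : Finset α).card
      = coverCount α k 3 + (coverCount α k 2 - coverCount α k 3)
          * ((if x = t then 1 else 0) + (if y = t then 1 else 0) + (if x = y then 1 else 0))
        + (coverCount α k 1 - 3 * coverCount α k 2 + 2 * coverCount α k 3)
          * ((if x = t then 1 else 0) * (if y = t then 1 else 0)) := by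
    intro x y
    by_cases h1 : x = t
    · subst h1
      by_cases h2 : y = x
      · subst h2; simp; ring
      · have : ({x, y, x} : Finset α) = {y, x} := by ext; simp
        rw [this, card_pair h2]
        simp [h2, Ne.symm h2]
    · by_cases h2 : y = t
      · subst h2; simp [h1, card_pair h1]
      · by_cases h3 : x = y
        · subst h3; simp [h1, card_pair h1]
        · rw [card_eq_three.mpr ⟨x, y, t, h3, h1, h2, rfl⟩]; simp [h1, h2, h3]
  have h3 : ∑ A ∈ layer α k, (∑ x ∈ A, a x) ^ 2 * (if t ∈ A then (1 : ℝ) else 0)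
      = ∑ x, ∑ y, a x * a y * coverCount α k ({x, y, t} : Finset α).card := by
    rw [sum_congr rfl h1, sum_comm]
    refine sum_congr rfl fun x _ => ?_
    rw [sum_comm]
    refine sum_congr rfl fun y _ => ?_
    rw [← mul_sum, sum_layer_superset k hk]
  have h4 : ∑ x, ∑ y, a x * a y * coverCount α k ({x, y, t} : Finset α).card
      = (coverCount α k 2 - coverCount α k 3) * ∑ x, a x ^ 2
        + (coverCount α k 1 - 3 * coverCount α k 2 + 2 * coverCount α k 3) * a t ^ 2 := by
    have hx : ∀ x ∈ (univ : Finset α), ∑ y, a x * a y * coverCount α k ({x, y, t} : Finset α).card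
        = (coverCount α k 2 - coverCount α k 3) * (a t * a x + a x ^ 2)
          + if x = t then (coverCount α k 1 - 3 * coverCount α k 2 + 2 * coverCount α k 3) * a t ^ 2
            else 0 := by
      intro x _
      simp only [h2, mul_add, sum_add_distrib]
      have e1 : ∑ y, a x * a y * coverCount α k 3 = 0 := by
        rw [← sum_mul, ← mul_sum, ha]; ring
      have e2 : ∑ y, a x * a y * ((coverCount α k 2 - coverCount α k 3) * if x = t then 1 else 0)
          = 0 := by
        rw [← sum_mul, ← mul_sum, ha]; ring
      rw [e1, e2]
      by_cases h : x = t
      · subst h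
        simp
        ring
      · simp [h]
        ring
    rw [sum_congr rfl hx, sum_add_distrib, ← mul_sum, sum_add_distrib, ← mul_sum, ha]
    simp
  rw [h3, h4]
  have := coverCount_nonneg (α := α) k 3
  have h5 : 0 ≤ ∑ x, a x ^ 2 := sum_nonneg fun _ _ => sq_nonneg _
  nlinarith [mul_nonneg this h5, sq_nonneg (a t), mul_nonneg this (sq_nonneg (a t)),
    mul_nonneg (sub_nonneg.mpr h32) (sq_nonneg (a t)),
    mul_nonneg (coverCount_nonneg (α := α) k 2) (sq_nonneg (a t))]

theorem sum_offDiag_eq (φ : α → α → ℝ) :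
    ∑ q ∈ (univ : Finset α).offDiag, φ q.1 q.2 = ∑ z, ∑ w, φ z w - ∑ z, φ z z := by
  have h : (univ : Finset α).offDiag = (univ ×ˢ univ).filter (fun q => ¬ q.1 = q.2) := by
    ext q; simp
  rw [h, ← sum_product', ← sum_filter_add_sum_filter_not (univ ×ˢ univ) (fun q => q.1 = q.2)
    (fun q => φ q.1 q.2)]
  have h2 : ∑ q ∈ (univ ×ˢ univ : Finset (α × α)) with q.1 = q.2, φ q.1 q.2 = ∑ z, φ z z := by
    rw [sum_filter, sum_product]
    simp
  rw [h2]; ring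

-- Since x ≠ y and z ≠ w, coincidences form a partial matching between {x, y} and {z, w}. This is
-- inclusion–exclusion over the four single matches and the two perfect ones.
omit [Fintype α] in
theorem card_quad {x y z w : α} (hxy : x ≠ y) (hzw : z ≠ w) (c : ℕ → ℝ) :
    c ({x, y, z, w} : Finset α).card
      = c 4 + (c 3 - c 4) * ((if z = x then 1 else 0) + (if z = y then 1 else 0)
          + (if w = x then 1 else 0) + (if w = y then 1 else 0))
        + (c 2 - 2 * c 3 + c 4) * ((if z = x then 1 else 0) * (if w = y then 1 else 0)
          + (if z = y then 1 else 0) * (if w = x then 1 else 0)) := by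
  by_cases h1 : z = x
  · subst h1
    by_cases h2 : w = y
    · subst h2
      have : ({z, w, z, w} : Finset α) = {z, w} := by ext; simp
      rw [this, card_pair hxy]
      simp [hzw, Ne.symm hzw]
      ring
    · have : ({z, y, z, w} : Finset α) = {z, y, w} := by ext; simp; tauto
      rw [this, card_eq_three.mpr ⟨z, y, w, hxy, hzw, Ne.symm h2, rfl⟩]
      simp [h2, hxy, Ne.symm hzw]
  · by_cases h2 : z = y
    · subst h2
      by_cases h3 : w = x
      · subst h3
        have : ({w, z, z, w} : Finset α) = {w, z} := by ext; simp; tauto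
        rw [this, card_pair hxy]
        simp [Ne.symm hxy, hxy]
        ring
      · have : ({x, z, z, w} : Finset α) = {x, z, w} := by ext; simp
        rw [this, card_eq_three.mpr ⟨x, z, w, hxy, Ne.symm h3, hzw, rfl⟩]
        simp [h1, h3, Ne.symm hzw]
    · by_cases h3 : w = x
      · subst h3
        have : ({w, y, z, w} : Finset α) = {w, y, z} := by ext; simp; tauto
        rw [this, card_eq_three.mpr ⟨w, y, z, hxy, Ne.symm h1, Ne.symm h2, rfl⟩]
        simp [h1, h2, hxy]
      · by_cases h4 : w = y
        · subst h4
          have : ({x, w, z, w} : Finset α) = {x, w, z} := by ext; simp; tauto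
          rw [this, card_eq_three.mpr ⟨x, w, z, hxy, Ne.symm h1, Ne.symm h2, rfl⟩]
          simp [h1, h2, h3]
        · have : ({x, y, z, w} : Finset α).card = 4 := by
            rw [card_insert_of_notMem (by simp [hxy, Ne.symm h1, Ne.symm h3]),
              card_eq_three.mpr ⟨y, z, w, Ne.symm h2, Ne.symm h4, hzw, rfl⟩]
          rw [this]
          simp [h1, h2, h3, h4]

theorem sum_offDiag_quad (a : α → ℝ) (ha : ∑ x, a x = 0) {x y : α} (hxy : x ≠ y) (c : ℕ → ℝ) :
    ∑ q ∈ (univ : Finset α).offDiag, a q.1 * a q.2 * c ({x, y, q.1, q.2} : Finset α).card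
      = -c 4 * ∑ z, a z ^ 2 - 2 * (c 3 - c 4) * (a x ^ 2 + a y ^ 2)
        + 2 * (c 2 - 2 * c 3 + c 4) * (a x * a y) := by
  have h1 : ∀ q ∈ (univ : Finset α).offDiag,
      a q.1 * a q.2 * c ({x, y, q.1, q.2} : Finset α).card
      = a q.1 * a q.2 * (c 4 + (c 3 - c 4) * ((if q.1 = x then 1 else 0)
          + (if q.1 = y then 1 else 0) + (if q.2 = x then 1 else 0) + (if q.2 = y then 1 else 0))
        + (c 2 - 2 * c 3 + c 4) * ((if q.1 = x then 1 else 0) * (if q.2 = y then 1 else 0)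
          + (if q.1 = y then 1 else 0) * (if q.2 = x then 1 else 0))) := by
    intro q hq
    rw [card_quad hxy (mem_offDiag.mp hq).2.2 c]
  rw [sum_congr rfl h1, sum_offDiag_eq (fun z w => a z * a w * (c 4 + (c 3 - c 4)
    * ((if z = x then 1 else 0) + (if z = y then 1 else 0) + (if w = x then 1 else 0)
      + (if w = y then 1 else 0))
    + (c 2 - 2 * c 3 + c 4) * ((if z = x then 1 else 0) * (if w = y then 1 else 0)
      + (if z = y then 1 else 0) * (if w = x then 1 else 0))))]
  have e0 : ∑ z, ∑ w, a z * a w * c 4 = 0 := by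
    refine sum_eq_zero fun z _ => ?_
    rw [← sum_mul, ← mul_sum, ha]; ring
  have e1 : ∀ v : α, ∑ z, ∑ w, a z * a w * ((c 3 - c 4) * (if z = v then 1 else 0)) = 0 := by
    intro v
    refine sum_eq_zero fun z _ => ?_
    rw [← sum_mul, ← mul_sum, ha]; ring
  have e2 : ∀ v : α, ∑ z, ∑ w, a z * a w * ((c 3 - c 4) * (if w = v then 1 else 0)) = 0 := by
    intro v
    rw [sum_comm]
    refine sum_eq_zero fun z _ => ?_
    rw [← sum_mul, ← sum_mul, ha]; ring
  have e3 : ∀ u v : α, ∑ z, ∑ w, a z * a w * ((c 2 - 2 * c 3 + c 4)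
      * ((if z = u then 1 else 0) * (if w = v then 1 else 0)))
      = (c 2 - 2 * c 3 + c 4) * (a u * a v) := by
    intro u v
    simp only [mul_ite, mul_one, mul_zero]
    simp
    ring
  have d0 : ∑ z, a z * a z * c 4 = c 4 * ∑ z, a z ^ 2 := by
    rw [mul_sum]; exact sum_congr rfl fun z _ => by ring
  have d1 : ∀ v : α, ∑ z, a z * a z * ((c 3 - c 4) * (if z = v then 1 else 0))
      = (c 3 - c 4) * a v ^ 2 := by
    intro v
    simp
    ring
  have d2 : ∑ z, a z * a z * ((c 2 - 2 * c 3 + c 4)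
      * ((if z = x then 1 else 0) * (if z = y then 1 else 0))) = 0 := by
    refine sum_eq_zero fun z _ => ?_
    by_cases h : z = x
    · subst h; simp [hxy]
    · simp [h]
  have d3 : ∑ z, a z * a z * ((c 2 - 2 * c 3 + c 4)
      * ((if z = y then 1 else 0) * (if z = x then 1 else 0))) = 0 := by
    refine sum_eq_zero fun z _ => ?_
    by_cases h : z = x
    · subst h; simp [hxy]
    · simp [h]
  simp only [mul_add, sum_add_distrib] at e3 d2 d3 ⊢
  simp only [e0, e1, e2, e3, d0, d1, d2, d3]
  ring

/-- Fourth moment bound for the quadratic part of the square of a linear function. -/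
theorem sum_layer_offDiag_sq_le (k : ℕ) (hk : k ≤ Fintype.card α) (a : α → ℝ)
    (ha : ∑ x, a x = 0) (h32 : 4 * coverCount α k 3 ≤ coverCount α k 2)
    (h43 : coverCount α k 4 ≤ coverCount α k 3) :
    ∑ A ∈ layer α k, ((∑ x ∈ A, a x) ^ 2 - ∑ x ∈ A, a x ^ 2) ^ 2
      ≤ 2 * coverCount α k 2 * (∑ x, a x ^ 2) ^ 2 := by
  set c := coverCount α k with hc
  have h1 : ∀ A ∈ layer α k, ((∑ x ∈ A, a x) ^ 2 - ∑ x ∈ A, a x ^ 2) ^ 2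
      = ∑ p ∈ (univ : Finset α).offDiag, ∑ q ∈ (univ : Finset α).offDiag,
        (a p.1 * a p.2) * (a q.1 * a q.2
          * if ({p.1, p.2, q.1, q.2} : Finset α) ⊆ A then 1 else 0) := by
    intro A _
    have e : (∑ x ∈ A, a x) ^ 2 - ∑ x ∈ A, a x ^ 2
        = ∑ p ∈ (univ : Finset α).offDiag,
          a p.1 * a p.2 * ((if p.1 ∈ A then 1 else 0) * if p.2 ∈ A then 1 else 0) := by
      rw [sum_offDiag_eq (fun x y => a x * a y * ((if x ∈ A then 1 else 0) * if y ∈ A then 1 else 0)),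
        sum_eq_sum_univ_indicator A a, sq, sum_mul_sum,
        sum_eq_sum_univ_indicator A (fun x => a x ^ 2)]
      congr 1
      · exact sum_congr rfl fun x _ => sum_congr rfl fun y _ => by ring
      · refine sum_congr rfl fun x _ => ?_
        by_cases h : x ∈ A <;> simp [h]
        ring
    rw [e, sq, sum_mul_sum]
    refine sum_congr rfl fun p _ => sum_congr rfl fun q _ => ?_
    by_cases h1 : p.1 ∈ A <;> by_cases h2 : p.2 ∈ A <;> by_cases h3 : q.1 ∈ A <;>
      by_cases h4 : q.2 ∈ A <;> simp [h1, h2, h3, h4, insert_subset_iff]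
  have h2 : ∑ A ∈ layer α k, ((∑ x ∈ A, a x) ^ 2 - ∑ x ∈ A, a x ^ 2) ^ 2
      = ∑ p ∈ (univ : Finset α).offDiag, (a p.1 * a p.2) *
          (-c 4 * ∑ z, a z ^ 2 - 2 * (c 3 - c 4) * (a p.1 ^ 2 + a p.2 ^ 2)
        + 2 * (c 2 - 2 * c 3 + c 4) * (a p.1 * a p.2)) := by
    rw [sum_congr rfl h1, sum_comm]
    refine sum_congr rfl fun p hp => ?_
    rw [← sum_offDiag_quad a ha (mem_offDiag.mp hp).2.2 c, sum_comm, mul_sum]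
    refine sum_congr rfl fun q _ => ?_
    rw [← mul_sum, ← mul_sum, sum_layer_superset k hk]
  set P := ∑ x, a x ^ 2 with hP
  have h3 : ∑ p ∈ (univ : Finset α).offDiag, (a p.1 * a p.2) *
          (-c 4 * P - 2 * (c 3 - c 4) * (a p.1 ^ 2 + a p.2 ^ 2)
        + 2 * (c 2 - 2 * c 3 + c 4) * (a p.1 * a p.2))
      = (3 * c 4 + 2 * c 2 - 4 * c 3) * P ^ 2
        + (8 * c 3 - 6 * c 4 - 2 * c 2) * ∑ x, a x ^ 4 := by
    rw [sum_offDiag_eq (fun x y => (a x * a y) *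
          (-c 4 * P - 2 * (c 3 - c 4) * (a x ^ 2 + a y ^ 2)
        + 2 * (c 2 - 2 * c 3 + c 4) * (a x * a y)))]
    have e1 : ∀ x ∈ (univ : Finset α), ∑ y, (a x * a y) *
          (-c 4 * P - 2 * (c 3 - c 4) * (a x ^ 2 + a y ^ 2)
        + 2 * (c 2 - 2 * c 3 + c 4) * (a x * a y))
        = a x * (- 2 * (c 3 - c 4) * ∑ y, a y ^ 3) + a x ^ 2 * (2 * (c 2 - 2 * c 3 + c 4) * P) := by
      intro x _
      have : ∀ y ∈ (univ : Finset α), (a x * a y) *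
          (-c 4 * P - 2 * (c 3 - c 4) * (a x ^ 2 + a y ^ 2)
        + 2 * (c 2 - 2 * c 3 + c 4) * (a x * a y))
        = (a x * (-c 4 * P - 2 * (c 3 - c 4) * a x ^ 2)) * a y
          + (a x * (- 2 * (c 3 - c 4))) * a y ^ 3 + (a x ^ 2 * (2 * (c 2 - 2 * c 3 + c 4))) * a y ^ 2 := by
        intro y _; ring
      rw [sum_congr rfl this, sum_add_distrib, sum_add_distrib, ← mul_sum, ← mul_sum, ← mul_sum, ha,
        ← hP]
      ring
    rw [sum_congr rfl e1, sum_add_distrib, ← sum_mul, ← sum_mul, ha, ← hP]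
    have e2 : ∀ x ∈ (univ : Finset α), (a x * a x) *
          (-c 4 * P - 2 * (c 3 - c 4) * (a x ^ 2 + a x ^ 2)
        + 2 * (c 2 - 2 * c 3 + c 4) * (a x * a x))
        = (-c 4 * P) * a x ^ 2 + (- 4 * (c 3 - c 4) + 2 * (c 2 - 2 * c 3 + c 4)) * a x ^ 4 := by
      intro x _; ring
    rw [sum_congr rfl e2, sum_add_distrib, ← mul_sum, ← mul_sum, ← hP]
    ring
  rw [h2, h3]
  have n3 : 0 ≤ c 3 := coverCount_nonneg k 3
  have n4 : 0 ≤ c 4 := coverCount_nonneg k 4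
  have q4 : 0 ≤ ∑ x, a x ^ 4 := sum_nonneg fun _ _ => by positivity
  -- The moment has just been computed exactly. The hypothesis 4c₃ ≤ c₂ makes the coefficient of ∑a⁴
  -- nonpositive, and c₄ ≤ c₃ gives 3c₄ - 4c₃ ≤ 0 in the coefficient of (∑a²)².
  have e1 : (8 * c 3 - 6 * c 4 - 2 * c 2) * ∑ x, a x ^ 4 ≤ 0 :=
    mul_nonpos_of_nonpos_of_nonneg (by linarith) q4
  have e2 : (3 * c 4 + 2 * c 2 - 4 * c 3) * P ^ 2 ≤ 2 * c 2 * P ^ 2 :=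
    mul_le_mul_of_nonneg_right (by linarith) (sq_nonneg _)
  linarith

end LevelOne

/-! ### Spectral decomposition of a family and the lower bound for its maximum degree. -/

section Family

variable {α : Type*} [Fintype α] [DecidableEq α]

/-- Number of members of `H` through `x`. -/
noncomputable def pointDegree (H : Finset (Finset α)) (x : α) : ℝ :=
  ((H.filter (fun A => x ∈ A)).card : ℝ)

/-- Indicator function of a family. -/
noncomputable def familyInd (H : Finset (Finset α)) (A : Finset α) : ℝ := if A ∈ H then 1 else 0

/-- The coefficients of the level-one part of the indicator function of `H`. -/
noncomputable def levelOneCoeff (k : ℕ) (H : Finset (Finset α)) (x : α) : ℝ :=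
  (pointDegree H x - k * H.card / Fintype.card α) / (coverCount α k 1 - coverCount α k 2)

/-- The level-one part of the indicator function of `H`. -/
noncomputable def levelOne (k : ℕ) (H : Finset (Finset α)) (A : Finset α) : ℝ :=
  ∑ x ∈ A, levelOneCoeff k H x

/-- The squared norm of the level-one part. -/
noncomputable def levelOneMass (k : ℕ) (H : Finset (Finset α)) : ℝ :=
  ∑ A ∈ layer α k, levelOne k H A ^ 2

/-- The part of the indicator function of `H` on levels at least two. -/
noncomputable def higherLevels (k : ℕ) (H : Finset (Finset α)) (A : Finset α) : ℝ :=
  familyInd H A - H.card / (Fintype.card α).choose k - levelOne k H A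

theorem sum_mul_familyInd {k : ℕ} {H : Finset (Finset α)} (hH : H ⊆ layer α k)
    (φ : Finset α → ℝ) : ∑ A ∈ layer α k, φ A * familyInd H A = ∑ A ∈ H, φ A := by
  simp only [familyInd, mul_ite, mul_one, mul_zero]
  rw [← sum_filter, filter_mem_eq_inter, inter_eq_right.mpr hH]

theorem sum_pointDegree (H : Finset (Finset α)) (φ : α → ℝ) :
    ∑ x, φ x * pointDegree H x = ∑ A ∈ H, ∑ x ∈ A, φ x := by
  have h : ∀ x ∈ (univ : Finset α), φ x * pointDegree H x
      = ∑ A ∈ H, φ x * if x ∈ A then 1 else 0 := by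
    intro x _
    rw [pointDegree, ← mul_sum, sum_boole]
  rw [sum_congr rfl h, sum_comm]
  exact sum_congr rfl fun A _ => (sum_eq_sum_univ_indicator A φ).symm

omit [DecidableEq α] in
theorem coverCount_one (k : ℕ) (hk1 : 1 ≤ k) (hk : k ≤ Fintype.card α) :
    coverCount α k 1 = ((Fintype.card α - 1).choose (k - 1) : ℝ) := by
  rw [coverCount]
  congr 1
  exact Nat.choose_symm_of_eq_add (by omega)

omit [DecidableEq α] in
theorem coverCount_two (k : ℕ) (hk1 : 2 ≤ k) (hk : k ≤ Fintype.card α) :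
    coverCount α k 2 = ((Fintype.card α - 2).choose (k - 2) : ℝ) := by
  rw [coverCount]
  congr 1
  exact Nat.choose_symm_of_eq_add (by omega)

omit [DecidableEq α] in
theorem coverCount_sub (k : ℕ) (hk1 : 2 ≤ k) (hk : k ≤ Fintype.card α) :
    coverCount α k 1 - coverCount α k 2 = ((Fintype.card α - 2).choose (k - 1) : ℝ) := by
  rw [coverCount_one k (by omega) hk, coverCount_two k hk1 hk]
  have h : Fintype.card α - 1 = (Fintype.card α - 2) + 1 := by omega
  have h2 : k - 1 = (k - 2) + 1 := by omega
  rw [h, h2, Nat.choose_succ_succ]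
  push_cast
  ring

omit [DecidableEq α] in
theorem card_mul_coverCount_one (k : ℕ) (hk1 : 1 ≤ k) (hk : k ≤ Fintype.card α) :
    (Fintype.card α : ℝ) * coverCount α k 1 = k * ((Fintype.card α).choose k : ℝ) := by
  rw [coverCount_one k hk1 hk]
  have h : Fintype.card α = (Fintype.card α - 1) + 1 := by omega
  have h2 : k = (k - 1) + 1 := by omega
  have := Nat.add_one_mul_choose_eq (Fintype.card α - 1) (k - 1)
  rw [← h, ← h2] at this
  have h3 : ((Fintype.card α * (Fintype.card α - 1).choose (k - 1) : ℕ) : ℝ)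
      = (((Fintype.card α).choose k * k : ℕ) : ℝ) := by rw [this]
  push_cast at h3
  linarith

omit [DecidableEq α] in
theorem coverCount_succ_mul (k j : ℕ) (hj : j + 1 ≤ k) (hk : k ≤ Fintype.card α) :
    ((Fintype.card α : ℝ) - j) * coverCount α k (j + 1) = ((k : ℝ) - j) * coverCount α k j := by
  have h := Nat.choose_mul_succ_eq (Fintype.card α - (j + 1)) (Fintype.card α - k)
  have e1 : Fintype.card α - (j + 1) + 1 = Fintype.card α - j := by omega
  rw [e1] at h
  have e2 : Fintype.card α - j - (Fintype.card α - k) = k - j := by omega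
  rw [e2] at h
  have h3 := congrArg (Nat.cast (R := ℝ)) h
  rw [Nat.cast_mul, Nat.cast_mul, Nat.cast_sub (by omega), Nat.cast_sub (by omega)] at h3
  rw [coverCount, coverCount]
  linarith

omit [DecidableEq α] in
theorem coverCount_anti (k j : ℕ) : coverCount α k (j + 1) ≤ coverCount α k j := by
  rw [coverCount, coverCount]
  exact_mod_cast Nat.choose_le_choose _ (by omega)

omit [DecidableEq α] in
theorem coverCount_eq_zero (k j : ℕ) (hj : k < j) (hk : j ≤ Fintype.card α) :
    coverCount α k j = 0 := by
  rw [coverCount, Nat.choose_eq_zero_of_lt (by omega), Nat.cast_zero]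

variable {k : ℕ} {H : Finset (Finset α)}

theorem sum_levelOneCoeff (hn : 0 < Fintype.card α) (hH : H ⊆ layer α k) :
    ∑ x, levelOneCoeff k H x = 0 := by
  have h := sum_pointDegree H (fun _ => (1 : ℝ))
  simp only [one_mul] at h
  have h2 : ∀ A ∈ H, ∑ x ∈ A, (1 : ℝ) = k := by
    intro A hA
    rw [sum_const, mem_layer.mp (hH hA)]; simp
  rw [sum_congr rfl h2, sum_const, nsmul_eq_mul] at h
  have hn' : (Fintype.card α : ℝ) ≠ 0 := by positivity
  simp only [levelOneCoeff]
  rw [← sum_div, sum_sub_distrib, h, sum_const, card_univ, nsmul_eq_mul]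
  field_simp
  ring

theorem levelOneMass_eq (hk1 : 1 ≤ k) (hk : k ≤ Fintype.card α) (hH : H ⊆ layer α k) :
    levelOneMass k H = (coverCount α k 1 - coverCount α k 2) * ∑ x, levelOneCoeff k H x ^ 2 := by
  have h := sum_layer_sum_mul_sum k hk (levelOneCoeff k H) (levelOneCoeff k H)
    (sum_levelOneCoeff (by omega) hH)
  simp only [levelOneMass, levelOne, sq]
  exact h

theorem levelOneMass_nonneg : 0 ≤ levelOneMass k H := sum_nonneg fun _ _ => sq_nonneg _

/-- The linear part is an orthogonal projection of the indicator, so its inner product with the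
indicator is its own squared norm. -/
theorem sum_levelOne (hk1 : 1 ≤ k) (hk : k ≤ Fintype.card α) (hH : H ⊆ layer α k)
    (hR : coverCount α k 1 - coverCount α k 2 ≠ 0) :
    ∑ A ∈ H, levelOne k H A = levelOneMass k H := by
  have h0 := sum_levelOneCoeff (k := k) (by omega) hH
  have h1 : ∀ x ∈ (univ : Finset α), levelOneCoeff k H x * pointDegree H x
      = (coverCount α k 1 - coverCount α k 2) * levelOneCoeff k H x ^ 2
        + levelOneCoeff k H x * (k * H.card / Fintype.card α) := by
    intro x _
    have : pointDegree H x = (coverCount α k 1 - coverCount α k 2) * levelOneCoeff k H x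
        + k * H.card / Fintype.card α := by
      rw [levelOneCoeff]; field_simp; ring
    rw [this]; ring
  rw [levelOneMass_eq hk1 hk hH, mul_sum]
  have h2 := sum_pointDegree H (levelOneCoeff k H)
  rw [sum_congr rfl h1, sum_add_distrib, ← sum_mul, h0, zero_mul, add_zero] at h2
  exact h2.symm

/-- The normalisation of `levelOneCoeff` is made for this: pairing the linear part with the star of
x gives the degree of x minus k|H|/n, and pairing the constant part with it gives exactly k|H|/n. -/
theorem pointSumZero_higherLevels (hk1 : 1 ≤ k) (hk : k ≤ Fintype.card α) (hH : H ⊆ layer α k)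
    (hR : coverCount α k 1 - coverCount α k 2 ≠ 0) : PointSumZero k (higherLevels k H) := by
  intro x
  have h0 := sum_levelOneCoeff (k := k) (by omega) hH
  simp only [higherLevels, sub_mul, sum_sub_distrib]
  have h1 : ∑ A ∈ layer α k, familyInd H A * (if x ∈ A then (1 : ℝ) else 0) = pointDegree H x := by
    have := sum_mul_familyInd hH (fun A => if x ∈ A then (1 : ℝ) else 0)
    rw [sum_boole] at this
    rw [pointDegree, ← this]
    exact sum_congr rfl fun _ _ => mul_comm _ _
  have h2 : ∑ A ∈ layer α k, levelOne k H A * (if x ∈ A then (1 : ℝ) else 0)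
      = (coverCount α k 1 - coverCount α k 2) * levelOneCoeff k H x :=
    sum_layer_mem_mul_sum k hk _ h0 x
  have h3 : ∑ A ∈ layer α k, (if x ∈ A then (1 : ℝ) else 0) = coverCount α k 1 := by
    have := sum_layer_superset k hk {x}
    simpa using this
  rw [h1, h2, ← mul_sum, h3, levelOneCoeff]
  have hn : (0 : ℝ) < Fintype.card α := by exact_mod_cast (by omega : 0 < Fintype.card α)
  have hC : (0 : ℝ) < ((Fintype.card α).choose k : ℝ) := by exact_mod_cast Nat.choose_pos hk
  have h4 := card_mul_coverCount_one k hk1 hk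
  have h5 : coverCount α k 1 = k * ((Fintype.card α).choose k : ℝ) / Fintype.card α := by
    rw [← h4]; field_simp
  rw [mul_div_cancel₀ _ hR, h5]
  field_simp
  ring

theorem normSqLayer_higherLevels (hk1 : 1 ≤ k) (hk : k ≤ Fintype.card α) (hH : H ⊆ layer α k)
    (hR : coverCount α k 1 - coverCount α k 2 ≠ 0) :
    normSqLayer k (higherLevels k H)
      = H.card - (H.card : ℝ) ^ 2 / (Fintype.card α).choose k - levelOneMass k H := by
  have h0 := sum_levelOneCoeff (k := k) (by omega) hH
  set c : ℝ := H.card / (Fintype.card α).choose k with hc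
  have hC : (0 : ℝ) < ((Fintype.card α).choose k : ℝ) := by exact_mod_cast Nat.choose_pos hk
  have h1 : ∀ A ∈ layer α k, higherLevels k H A ^ 2
      = (1 - 2 * c - 2 * levelOne k H A) * familyInd H A + c ^ 2 + 2 * c * levelOne k H A
        + levelOne k H A ^ 2 := by
    intro A _
    have : familyInd H A ^ 2 = familyInd H A := by rw [familyInd]; split_ifs <;> norm_num
    rw [higherLevels, ← hc]
    linear_combination this
  rw [normSqLayer, sum_congr rfl h1, sum_add_distrib, sum_add_distrib, sum_add_distrib,
    sum_mul_familyInd hH, ← mul_sum]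
  have h2 : ∑ A ∈ layer α k, levelOne k H A = 0 := sum_layer_sum_eq_zero k hk1 _ h0
  rw [h2, sum_sub_distrib, ← mul_sum, sum_levelOne hk1 hk hH hR, sum_const, sum_const,
    card_powersetCard, card_univ, nsmul_eq_mul, nsmul_eq_mul]
  rw [levelOneMass, hc]
  field_simp
  ring

theorem levelOneMass_le_card (hk1 : 1 ≤ k) (hk : k ≤ Fintype.card α) (hH : H ⊆ layer α k)
    (hR : coverCount α k 1 - coverCount α k 2 ≠ 0) : levelOneMass k H ≤ H.card := by
  have h := normSqLayer_higherLevels hk1 hk hH hR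
  have h1 := normSqLayer_nonneg k (higherLevels k H)
  have h2 : 0 ≤ (H.card : ℝ) ^ 2 / (Fintype.card α).choose k := by positivity
  linarith

theorem normSqLayer_higherLevels_le (hk1 : 1 ≤ k) (hk : k ≤ Fintype.card α) (hH : H ⊆ layer α k)
    (hR : coverCount α k 1 - coverCount α k 2 ≠ 0) :
    normSqLayer k (higherLevels k H) ≤ H.card := by
  have h := normSqLayer_higherLevels hk1 hk hH hR
  have h1 := levelOneMass_nonneg (k := k) (H := H)
  have h2 : 0 ≤ (H.card : ℝ) ^ 2 / (Fintype.card α).choose k := by positivity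
  linarith

theorem sum_kneserSum_eq (hk1 : 1 ≤ k) (hk : k ≤ Fintype.card α) (hH : H ⊆ layer α k)
    {M : Finset (Finset α)} (hM : M ⊆ layer α k) :
    ∑ B ∈ M, kneserSum k (familyInd H) B
      = (Fintype.card α - k).choose k * (H.card / (Fintype.card α).choose k) * M.card
        - (Fintype.card α - k - 1).choose (k - 1) * ∑ B ∈ M, levelOne k H B
        + ∑ B ∈ M, kneserSum k (higherLevels k H) B := by
  have h0 := sum_levelOneCoeff (k := k) (by omega) hH
  have h1 : ∀ B ∈ M, kneserSum k (familyInd H) B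
      = (Fintype.card α - k).choose k * (H.card / (Fintype.card α).choose k)
        - (Fintype.card α - k - 1).choose (k - 1) * levelOne k H B
        + kneserSum k (higherLevels k H) B := by
    intro B hB
    have hBk := mem_layer.mp (hM hB)
    have h2 := kneserSum_sum k hk1 (levelOneCoeff k H) h0 B hBk
    have h3 : kneserSum k (higherLevels k H) B = kneserSum k (familyInd H) B
        - kneserSum k (fun _ => (H.card : ℝ) / (Fintype.card α).choose k) B
        - kneserSum k (fun B => ∑ x ∈ B, levelOneCoeff k H x) B := by
      simp only [kneserSum, higherLevels, sum_sub_distrib, levelOne]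
    have h4 : kneserSum k (fun _ => (H.card : ℝ) / (Fintype.card α).choose k) B
        = (Fintype.card α - k).choose k * (H.card / (Fintype.card α).choose k) := by
      rw [kneserSum, sum_const, card_powersetCard, card_compl, hBk, nsmul_eq_mul]
    rw [h3, h2, h4, levelOne]
    ring
  rw [sum_congr rfl h1, sum_add_distrib, sum_sub_distrib, sum_const, ← mul_sum, nsmul_eq_mul]
  ring

/-- Cauchy–Schwarz over M, the operator norm bound, and the fact that the remaining part has squared
norm at most |H|. The condition |M| ≤ |H| makes the result linear in |H|, so it survives averaging
over H. -/
theorem abs_sum_kneserSum_higherLevels_le (hk2 : 2 ≤ k) (hk : 2 * k ≤ Fintype.card α)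
    (hH : H ⊆ layer α k) (hR : coverCount α k 1 - coverCount α k 2 ≠ 0)
    {M : Finset (Finset α)} (hM : M ⊆ layer α k) (hMH : M.card ≤ H.card) :
    |∑ B ∈ M, kneserSum k (higherLevels k H) B|
      ≤ (Fintype.card α - k - 2).choose (k - 2) * H.card := by
  have h1 := normSqLayer_kneserSum_le k hk2 hk (higherLevels k H)
    (pointSumZero_higherLevels (by omega) (by omega) hH hR)
  have h2 := normSqLayer_higherLevels_le (by omega) (by omega) hH hR
  have h3 : (∑ B ∈ M, kneserSum k (higherLevels k H) B) ^ 2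
      ≤ M.card * ∑ B ∈ M, kneserSum k (higherLevels k H) B ^ 2 := sq_sum_le_card_mul_sum_sq
  have h4 : ∑ B ∈ M, kneserSum k (higherLevels k H) B ^ 2
      ≤ normSqLayer k (kneserSum k (higherLevels k H)) :=
    sum_le_sum_of_subset_of_nonneg hM fun _ _ _ => sq_nonneg _
  refine abs_le_of_sq_le_sq ?_ (by positivity)
  have h5 : (M.card : ℝ) ≤ H.card := by exact_mod_cast hMH
  calc (∑ B ∈ M, kneserSum k (higherLevels k H) B) ^ 2
      ≤ M.card * ∑ B ∈ M, kneserSum k (higherLevels k H) B ^ 2 := h3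
    _ ≤ H.card * (((Fintype.card α - k - 2).choose (k - 2) : ℝ) ^ 2 * H.card) := by
        refine mul_le_mul h5 (h4.trans (h1.trans ?_)) (sum_nonneg fun _ _ => sq_nonneg _)
          (by positivity)
        exact mul_le_mul_of_nonneg_left h2 (by positivity)
    _ = _ := by ring

/-- If all point degrees are at most `δ`, the level-one part of `H` has small norm. -/
theorem levelOneMass_le (hk2 : 2 ≤ k) (hk : 4 * k ≤ Fintype.card α)
    (hH : H ⊆ layer α k) (δ : ℝ) (hδ : ∀ x, pointDegree H x ≤ δ) :
    levelOneMass k H ≤ H.card * ((δ + √(2 * coverCount α k 2 * H.card))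
      / (coverCount α k 1 - coverCount α k 2)) := by
  have hRpos : 0 < coverCount α k 1 - coverCount α k 2 := by
    rw [coverCount_sub k hk2 (by omega)]
    exact_mod_cast Nat.choose_pos (by omega)
  set R := coverCount α k 1 - coverCount α k 2 with hRdef
  set a := levelOneCoeff k H with ha
  set Q := levelOneMass k H with hQ
  set P := ∑ x, a x ^ 2 with hP
  have h0 : ∑ x, a x = 0 := sum_levelOneCoeff (k := k) (by omega) hH
  have hQP : Q = R * P := levelOneMass_eq (by omega) (by omega) hH
  have hP0 : 0 ≤ P := sum_nonneg fun _ _ => sq_nonneg _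
  have hQ0 : 0 ≤ Q := levelOneMass_nonneg
  have h43 : coverCount α k 4 ≤ coverCount α k 3 := coverCount_anti k 3
  -- For k = 2 no set contains three points, so c₃ = 0. Otherwise c₃/c₂ = (k-2)/(n-2), at most 1/4
  -- since n ≥ 4k.
  have h32 : 4 * coverCount α k 3 ≤ coverCount α k 2 := by
    rcases hk2.eq_or_lt with h | h
    · rw [coverCount_eq_zero k 3 (by omega) (by omega), mul_zero]
      exact coverCount_nonneg k 2
    · have h1 := coverCount_succ_mul (α := α) k 2 (by omega) (by omega)
      have h2 : (4 : ℝ) * k ≤ Fintype.card α := by exact_mod_cast hk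
      have h3 := coverCount_nonneg (α := α) k 2
      have h4 := coverCount_nonneg (α := α) k 3
      have h5 : (2 : ℝ) < k := by exact_mod_cast h
      push_cast at h1
      have h6 : (4 * ((k : ℝ) - 2)) * coverCount α k 3 ≤ ((k : ℝ) - 2) * coverCount α k 2 := by
        nlinarith
      have h7 : 0 < (k : ℝ) - 2 := by linarith
      nlinarith
  have hW := sum_layer_offDiag_sq_le k (by omega) a h0 h32 h43
  have hsum : ∑ A ∈ H, levelOne k H A = Q := sum_levelOne (by omega) (by omega) hH hRpos.ne'
  -- Q is the sum of the linear part over H, so Cauchy–Schwarz leads to the sum of its squares over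
  -- H. The diagonal terms a_x² are weighted by degrees and cost at most δP; the off-diagonal ones
  -- are controlled by their second moment over the whole layer. Both are multiples of P = Q/R, so
  -- one factor Q cancels.
  have hcs : Q ^ 2 ≤ H.card * ∑ A ∈ H, levelOne k H A ^ 2 := by
    rw [← hsum]; exact sq_sum_le_card_mul_sum_sq
  have hsplit : ∑ A ∈ H, levelOne k H A ^ 2
      = ∑ A ∈ H, ((∑ x ∈ A, a x) ^ 2 - ∑ x ∈ A, a x ^ 2) + ∑ x, a x ^ 2 * pointDegree H x := by
    rw [sum_pointDegree H (fun x => a x ^ 2), ← sum_add_distrib]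
    exact sum_congr rfl fun A _ => by rw [levelOne]; ring
  have hdiag : ∑ x, a x ^ 2 * pointDegree H x ≤ δ * P := by
    rw [hP, mul_sum]
    exact sum_le_sum fun x _ => by nlinarith [hδ x, sq_nonneg (a x)]
  have hoff : ∑ A ∈ H, ((∑ x ∈ A, a x) ^ 2 - ∑ x ∈ A, a x ^ 2)
      ≤ √(2 * coverCount α k 2 * H.card) * P := by
    refine le_of_abs_le (abs_le_of_sq_le_sq ?_
      (mul_nonneg (Real.sqrt_nonneg _) hP0))
    rw [mul_pow, Real.sq_sqrt (mul_nonneg (mul_nonneg zero_le_two (coverCount_nonneg _ _))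
      (Nat.cast_nonneg _))]
    calc _ ≤ (H.card : ℝ) * ∑ A ∈ H, ((∑ x ∈ A, a x) ^ 2 - ∑ x ∈ A, a x ^ 2) ^ 2 :=
          sq_sum_le_card_mul_sum_sq
      _ ≤ H.card * (2 * coverCount α k 2 * P ^ 2) := by
          refine mul_le_mul_of_nonneg_left (le_trans ?_ hW) (Nat.cast_nonneg _)
          exact sum_le_sum_of_subset_of_nonneg hH fun _ _ _ => sq_nonneg _
      _ = _ := by ring
  rcases hQ0.eq_or_lt with h | h
  · rw [← h]
    rcases H.eq_empty_or_nonempty with rfl | ⟨A, hA⟩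
    · simp
    · have hc : (0 : ℝ) < Fintype.card α := by exact_mod_cast (by omega : 0 < Fintype.card α)
      have hx : (Finset.univ : Finset α).Nonempty := by
        rw [← card_pos, card_univ]; omega
      obtain ⟨x, -⟩ := hx
      have : 0 ≤ δ := le_trans (by rw [pointDegree]; positivity) (hδ x)
      positivity
  · have h1 : Q ^ 2 ≤ H.card * ((√(2 * coverCount α k 2 * H.card) + δ) * P) := by
      refine hcs.trans (mul_le_mul_of_nonneg_left ?_ (Nat.cast_nonneg _))
      rw [hsplit]; linarith
    have hPQ : P = Q / R := by rw [hQP]; field_simp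
    rw [hPQ] at h1
    have h2 : Q * Q ≤ (H.card * ((δ + √(2 * coverCount α k 2 * H.card)) / R)) * Q := by
      calc Q * Q = Q ^ 2 := (sq Q).symm
        _ ≤ _ := h1
        _ = _ := by ring
    exact le_of_mul_le_mul_right h2 h

/-- The level-one part of `H` has small sum over a family covered by few points of degree zero. -/
theorem abs_sum_levelOne_le (hk2 : 2 ≤ k) (hk : 4 * k ≤ Fintype.card α)
    (hH : H ⊆ layer α k) (T : Finset α) (hT : ∀ t ∈ T, pointDegree H t = 0)
    {M : Finset (Finset α)} (hM : M ⊆ layer α k) (hMT : ∀ B ∈ M, ¬ Disjoint B T)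
    (hMH : M.card ≤ H.card) :
    |∑ B ∈ M, levelOne k H B| ≤ H.card * √(T.card *
      (coverCount α k 1 * (k / Fintype.card α) ^ 2 * H.card
          / (coverCount α k 1 - coverCount α k 2) ^ 2
        + coverCount α k 2 / (coverCount α k 1 - coverCount α k 2))) := by
  have hRpos : 0 < coverCount α k 1 - coverCount α k 2 := by
    rw [coverCount_sub k hk2 (by omega)]
    exact_mod_cast Nat.choose_pos (by omega)
  set R := coverCount α k 1 - coverCount α k 2 with hRdef
  set a := levelOneCoeff k H with ha
  set P := ∑ x, a x ^ 2 with hP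
  have h0 : ∑ x, a x = 0 := sum_levelOneCoeff (k := k) (by omega) hH
  have hQP : levelOneMass k H = R * P := levelOneMass_eq (by omega) (by omega) hH
  have hQH : levelOneMass k H ≤ H.card := levelOneMass_le_card (by omega) (by omega) hH hRpos.ne'
  have hPle : P ≤ H.card / R := by
    rw [le_div_iff₀ hRpos]; linarith
  have c1 := coverCount_nonneg (α := α) k 1
  have c2 := coverCount_nonneg (α := α) k 2
  -- Degree zero in H leaves only the centring term, so the coefficients on T are of relative order
  -- k/n.
  have hat : ∀ t ∈ T, a t = -(k / Fintype.card α * H.card / R) := by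
    intro t ht
    rw [ha, levelOneCoeff, hT t ht, ← hRdef]; ring
  -- Every member of M lies in the star of some t in T, so the sum over M is dominated by second
  -- moments over these full stars.
  have hsq : ∑ B ∈ M, levelOne k H B ^ 2 ≤ H.card * (T.card *
      (coverCount α k 1 * (k / Fintype.card α) ^ 2 * H.card / R ^ 2 + coverCount α k 2 / R)) := by
    calc ∑ B ∈ M, levelOne k H B ^ 2
        ≤ ∑ B ∈ M, ∑ t ∈ T, levelOne k H B ^ 2 * (if t ∈ B then 1 else 0) := by
          refine sum_le_sum fun B hB => ?_
          obtain ⟨t, htB, htT⟩ := not_disjoint_iff.mp (hMT B hB)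
          refine le_trans (le_of_eq ?_) (single_le_sum (fun t _ => ?_) htT)
          · simp [htB]
          · split_ifs <;> simp [sq_nonneg]
      _ ≤ ∑ B ∈ layer α k, ∑ t ∈ T, levelOne k H B ^ 2 * (if t ∈ B then 1 else 0) := by
          refine sum_le_sum_of_subset_of_nonneg hM fun B _ _ => sum_nonneg fun t _ => ?_
          split_ifs <;> simp [sq_nonneg]
      _ = ∑ t ∈ T, ∑ B ∈ layer α k, levelOne k H B ^ 2 * (if t ∈ B then 1 else 0) := sum_comm
      _ ≤ ∑ t ∈ T, (coverCount α k 1 * (k / Fintype.card α * H.card / R) ^ 2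
            + coverCount α k 2 * (H.card / R)) := by
          refine sum_le_sum fun t ht => ?_
          refine (sum_layer_mem_sum_sq_le k (by omega) a h0 t (coverCount_anti k 2)).trans ?_
          rw [hat t ht, neg_sq]
          exact add_le_add le_rfl (mul_le_mul_of_nonneg_left hPle c2)
      _ = _ := by
          rw [sum_const, nsmul_eq_mul]
          field_simp
  have hnn : (0 : ℝ) ≤ (T.card : ℝ) *
      (coverCount α k 1 * (k / Fintype.card α) ^ 2 * H.card / R ^ 2 + coverCount α k 2 / R) := by
    positivity
  refine abs_le_of_sq_le_sq ?_ (by positivity)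
  rw [mul_pow, Real.sq_sqrt hnn]
  have h5 : (M.card : ℝ) ≤ H.card := by exact_mod_cast hMH
  calc (∑ B ∈ M, levelOne k H B) ^ 2 ≤ M.card * ∑ B ∈ M, levelOne k H B ^ 2 :=
        sq_sum_le_card_mul_sum_sq
    _ ≤ H.card * (H.card * (T.card *
      (coverCount α k 1 * (k / Fintype.card α) ^ 2 * H.card / R ^ 2 + coverCount α k 2 / R))) :=
        mul_le_mul h5 hsq (sum_nonneg fun _ _ => sq_nonneg _) (Nat.cast_nonneg _)
    _ = _ := by ring

theorem kneserSum_familyInd (hH : H ⊆ layer α k) (A : Finset α) :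
    kneserSum k (familyInd H) A = ((H.filter (fun B => Disjoint A B)).card : ℝ) := by
  simp only [kneserSum, familyInd]
  rw [sum_boole]
  congr 2
  ext B
  simp only [mem_filter, mem_powersetCard]
  constructor
  · rintro ⟨⟨h1, _⟩, h2⟩
    exact ⟨h2, (disjoint_left.mpr fun x hx hxB => (mem_compl.mp (h1 hxB)) hx)⟩
  · rintro ⟨h1, h2⟩
    exact ⟨⟨fun x hx => mem_compl.mpr fun hA => disjoint_left.mp h2 hA hx,
      mem_layer.mp (hH h1)⟩, h1⟩

theorem card_layer_disjoint_hits (A T : Finset α) (hA : A.card = k) (hAT : Disjoint A T) :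
    (((layer α k).filter (fun B => ¬ Disjoint B T ∧ Disjoint A B)).card : ℝ)
      = (Fintype.card α - k).choose k - (Fintype.card α - k - T.card).choose k := by
  have h1 : ((layer α k).filter (fun B => Disjoint A B)).card = (Fintype.card α - k).choose k := by
    rw [← hA, ← card_compl, ← card_powersetCard]
    congr 1
    ext B
    rw [mem_filter, mem_layer, mem_powersetCard, disjoint_comm, subset_compl_iff_disjoint_right]
    tauto
  have h2 : ((layer α k).filter (fun B => Disjoint B T ∧ Disjoint A B)).card
      = (Fintype.card α - k - T.card).choose k := by
    have : Fintype.card α - k - T.card = (A ∪ T)ᶜ.card := by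
      rw [card_compl, card_union_of_disjoint hAT, hA]; omega
    rw [this, ← card_powersetCard]
    congr 1
    ext B
    rw [mem_filter, mem_layer, mem_powersetCard, disjoint_comm (a := A),
      subset_compl_iff_disjoint_right, disjoint_union_right]
    tauto
  have h3 := card_filter_add_card_filter_not (s := (layer α k).filter (fun B => Disjoint A B))
    (fun B => Disjoint B T)
  rw [filter_filter, filter_filter, h1] at h3
  have h4 : (layer α k).filter (fun B => Disjoint A B ∧ Disjoint B T)
      = (layer α k).filter (fun B => Disjoint B T ∧ Disjoint A B) := by
    ext; simp; tauto
  have h5 : (layer α k).filter (fun B => Disjoint A B ∧ ¬ Disjoint B T)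
      = (layer α k).filter (fun B => ¬ Disjoint B T ∧ Disjoint A B) := by
    ext; simp; tauto
  rw [h4, h5, h2] at h3
  rw [← h3]; push_cast; ring

/-- Lower bound for the maximum degree of a family `F` in terms of the part `H` of `F` avoiding
a set `T` of points, the family `M` of sets hitting `T` missing from `F`, and a bound `δ` for the
point degrees of `H`. -/
theorem maxDegree_lower_bound (hk2 : 2 ≤ k) (hk : 4 * k ≤ Fintype.card α)
    {F : Finset (Finset α)} (hF : F ⊆ layer α k) (T : Finset α) (Δ δ : ℝ)
    (hΔ : ∀ A ∈ F, ((F.filter (fun B => Disjoint A B)).card : ℝ) ≤ Δ)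
    (hH : H = F.filter (fun A => Disjoint A T)) (hHne : H.Nonempty)
    {M : Finset (Finset α)} (hM : M = ((layer α k).filter (fun A => ¬ Disjoint A T)) \ F)
    (hMH : M.card ≤ H.card) (hδ : ∀ x, pointDegree H x ≤ δ) :
    ((Fintype.card α - k).choose k : ℝ) - (Fintype.card α - k - T.card).choose k
      + (Fintype.card α - k).choose k / (Fintype.card α).choose k * ((H.card : ℝ) - M.card)
      - (Fintype.card α - k - 1).choose (k - 1)
        * ((δ + √(2 * coverCount α k 2 * H.card)) / (coverCount α k 1 - coverCount α k 2)
          + √(T.card * (coverCount α k 1 * (k / Fintype.card α) ^ 2 * H.card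
              / (coverCount α k 1 - coverCount α k 2) ^ 2
            + coverCount α k 2 / (coverCount α k 1 - coverCount α k 2))))
      - 2 * (Fintype.card α - k - 2).choose (k - 2) ≤ Δ := by
  have hHF : H ⊆ F := hH ▸ filter_subset _ _
  have hHl : H ⊆ layer α k := hHF.trans hF
  have hMl : M ⊆ layer α k := hM ▸ sdiff_subset.trans (filter_subset _ _)
  have hRpos : 0 < coverCount α k 1 - coverCount α k 2 := by
    rw [coverCount_sub k hk2 (by omega)]
    exact_mod_cast Nat.choose_pos (by omega)
  have hT : ∀ t ∈ T, pointDegree H t = 0 := by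
    intro t ht
    rw [pointDegree, Nat.cast_eq_zero, card_eq_zero, filter_eq_empty_iff]
    intro A hA htA
    rw [hH, mem_filter] at hA
    exact disjoint_left.mp hA.2 htA ht
  have hMT : ∀ B ∈ M, ¬ Disjoint B T := by
    intro B hB
    rw [hM, mem_sdiff, mem_filter] at hB
    exact hB.1.2
  have e1 := sum_kneserSum_eq (by omega) (by omega) hHl hHl
  have e2 := sum_kneserSum_eq (by omega) (by omega) hHl hMl
  have b1 := abs_le.mp (abs_sum_kneserSum_higherLevels_le hk2 (by omega) hHl hRpos.ne' hHl le_rfl)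
  have b2 := abs_le.mp (abs_sum_kneserSum_higherLevels_le hk2 (by omega) hHl hRpos.ne' hMl hMH)
  have b3 := levelOneMass_le hk2 hk hHl δ hδ
  have b4 := abs_le.mp (abs_sum_levelOne_le hk2 hk hHl T hT hMl hMT hMH)
  rw [sum_levelOne (by omega) (by omega) hHl hRpos.ne'] at e1
  -- Since A avoids T, its neighbours among all sets hitting T can be counted exactly; those absent
  -- from F are its neighbours in M.
  have hdeg : ∀ A ∈ H, ((Fintype.card α - k).choose k : ℝ)
      - (Fintype.card α - k - T.card).choose k + kneserSum k (familyInd H) A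
      - kneserSum k (familyInd M) A ≤ Δ := by
    intro A hA
    have hAk := mem_layer.mp (hHl hA)
    have hAT : Disjoint A T := by rw [hH, mem_filter] at hA; exact hA.2
    refine le_trans (le_of_eq ?_) (hΔ A (hHF hA))
    rw [← card_layer_disjoint_hits A T hAk hAT, kneserSum_familyInd hHl, kneserSum_familyInd hMl]
    have s1 : (F.filter (fun B => Disjoint A B)).card
        = (H.filter (fun B => Disjoint A B)).card
          + (F.filter (fun B => ¬ Disjoint B T ∧ Disjoint A B)).card := by
      have := card_filter_add_card_filter_not (s := F.filter (fun B => Disjoint A B))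
        (fun B => Disjoint B T)
      rw [← this, filter_filter, filter_filter, hH, filter_filter]
      congr 2 <;> (ext; simp; try tauto)
    have s2 : ((layer α k).filter (fun B => ¬ Disjoint B T ∧ Disjoint A B)).card
        = (M.filter (fun B => Disjoint A B)).card
          + (F.filter (fun B => ¬ Disjoint B T ∧ Disjoint A B)).card := by
      rw [← card_union_of_disjoint]
      · congr 1
        ext B
        simp only [mem_filter, mem_union, hM, mem_sdiff]
        have : B ∈ F → B ∈ layer α k := fun h => hF h
        tauto
      · rw [disjoint_left]
        intro B hB hB2
        simp only [mem_filter, hM, mem_sdiff] at hB hB2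
        exact hB.1.2 hB2.1
    rw [s1, s2]
    push_cast
    ring
  have hsum := sum_le_sum hdeg
  rw [sum_sub_distrib, sum_add_distrib, sum_const, sum_const, nsmul_eq_mul, nsmul_eq_mul] at hsum
  -- The pairs between H and M are counted from the side of M, so that only the decomposition of H
  -- is needed.
  have hsymm : ∑ A ∈ H, kneserSum k (familyInd M) A = ∑ B ∈ M, kneserSum k (familyInd H) B := by
    rw [sum_congr rfl fun A _ => kneserSum_familyInd hMl A,
      sum_congr rfl fun A _ => kneserSum_familyInd hHl A]
    have := sum_card_bipartiteAbove_eq_sum_card_bipartiteBelow (s := H) (t := M)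
      (fun A B => Disjoint A B)
    simp only [bipartiteAbove, bipartiteBelow] at this
    have h2 := congrArg (Nat.cast (R := ℝ)) this
    push_cast at h2
    rw [h2]
    refine sum_congr rfl fun B _ => ?_
    congr 2
    ext A
    simp [disjoint_comm]
  rw [hsymm, e1, e2] at hsum
  have hHpos : (0 : ℝ) < H.card := by exact_mod_cast hHne.card_pos
  have hL : (0 : ℝ) ≤ ((Fintype.card α - k - 1).choose (k - 1) : ℝ) := Nat.cast_nonneg _
  have t1 := mul_le_mul_of_nonneg_left b3 hL
  have t2 := mul_le_mul_of_nonneg_left b4.1 hL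
  refine le_of_mul_le_mul_left ?_ hHpos
  refine le_trans ?_ hsum
  have hid : (H.card : ℝ) * ((Fintype.card α - k).choose k / (Fintype.card α).choose k
      * ((H.card : ℝ) - M.card))
      = (Fintype.card α - k).choose k * (H.card / (Fintype.card α).choose k) * H.card
      - (Fintype.card α - k).choose k * (H.card / (Fintype.card α).choose k) * M.card := by
    ring
  nlinarith [hid, t1, t2, b1.1, b2.2]

end Family

/-! ### The competing family: part of each of s+1 stars. -/

section Construction

variable {α : Type*} [Fintype α] [DecidableEq α]

/-- The `k`-sets containing a point of `T` and another point of `Y`. -/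
def crossFamily (k : ℕ) (T Y : Finset α) : Finset (Finset α) :=
  (layer α k).filter (fun A => ∃ j ∈ A, j ∈ T ∧ ∃ w ∈ A, w ≠ j ∧ w ∈ Y)

theorem mem_crossFamily {k : ℕ} {T Y A : Finset α} :
    A ∈ crossFamily k T Y ↔ A.card = k ∧ ∃ j ∈ A, j ∈ T ∧ ∃ w ∈ A, w ≠ j ∧ w ∈ Y := by
  rw [crossFamily, mem_filter, mem_layer]

theorem crossFamily_mono (k : ℕ) (T : Finset α) {Y Z : Finset α} (h : Y ⊆ Z) :
    crossFamily k T Y ⊆ crossFamily k T Z := by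
  intro A hA
  rw [crossFamily, mem_filter] at hA ⊢
  obtain ⟨hk, j, hj, hjT, w, hw, hne, hwY⟩ := hA
  exact ⟨hk, j, hj, hjT, w, hw, hne, h hwY⟩

theorem crossFamily_subset (k : ℕ) (T Y : Finset α) :
    crossFamily k T Y ⊆ (layer α k).filter (fun A => ¬ Disjoint A T) := by
  intro A hA
  rw [crossFamily, mem_filter] at hA
  obtain ⟨hk, j, hj, hjT, -⟩ := hA
  exact mem_filter.mpr ⟨hk, not_disjoint_iff.mpr ⟨j, hj, hjT⟩⟩

theorem crossFamily_univ (k : ℕ) (hk : 2 ≤ k) (T : Finset α) :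
    crossFamily k T univ = (layer α k).filter (fun A => ¬ Disjoint A T) := by
  refine subset_antisymm (crossFamily_subset k T univ) fun A hA => ?_
  rw [mem_filter] at hA
  obtain ⟨j, hj, hjT⟩ := not_disjoint_iff.mp hA.2
  have hc := mem_layer.mp hA.1
  obtain ⟨w, hw, hne⟩ := exists_mem_ne (by omega : 1 < A.card) j
  exact mem_filter.mpr ⟨hA.1, j, hj, hjT, w, hw, hne, mem_univ _⟩

/-- Degrees of `k`-sets hitting `T` into the cross family. -/
theorem card_crossFamily_disjoint_le (k : ℕ) (hk : 1 ≤ k) {T Y A : Finset α} {s : ℕ}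
    (hT : T.card = s + 1) (hA : A.card = k) (hAT : ¬ Disjoint A T) :
    ((crossFamily k T Y).filter (fun B => Disjoint A B)).card
      ≤ s * ((Fintype.card α - k - 1).choose (k - 1)
        - (Fintype.card α - k - 1 - Y.card).choose (k - 1)) := by
  have hsub : (crossFamily k T Y).filter (fun B => Disjoint A B)
      ⊆ (T \ A).biUnion (fun j => (Aᶜ.powersetCard k).filter (fun B => j ∈ B)
        \ ((Aᶜ \ Y.erase j).powersetCard k).filter (fun B => j ∈ B)) := by
    intro B hB
    rw [mem_filter, crossFamily, mem_filter, mem_layer] at hB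
    obtain ⟨⟨hBk, j, hj, hjT, w, hw, hne, hwY⟩, hAB⟩ := hB
    rw [mem_biUnion]
    refine ⟨j, mem_sdiff.mpr ⟨hjT, fun h => disjoint_left.mp hAB h hj⟩, ?_⟩
    rw [mem_sdiff, mem_filter, mem_powersetCard, mem_filter, mem_powersetCard]
    refine ⟨⟨⟨subset_compl_iff_disjoint_left.mpr hAB, hBk⟩, hj⟩, ?_⟩
    rintro ⟨⟨h, -⟩, -⟩
    exact (mem_sdiff.mp (h hw)).2 (mem_erase.mpr ⟨hne, hwY⟩)
  -- A itself contains one of the s+1 centres, and a set disjoint from A cannot use that centre.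
  have hTA : (T \ A).card ≤ s := by
    obtain ⟨x, hxA, hxT⟩ := not_disjoint_iff.mp hAT
    have : T \ A ⊆ T.erase x := fun y hy => by
      rw [mem_sdiff] at hy
      exact mem_erase.mpr ⟨fun h => hy.2 (h ▸ hxA), hy.1⟩
    have := card_le_card this
    rw [card_erase_of_mem hxT, hT] at this
    omega
  refine (card_le_card hsub).trans ((card_biUnion_le_card_mul _ _ _ fun j hj => ?_).trans
    (Nat.mul_le_mul_right _ hTA))
  rw [mem_sdiff] at hj
  rw [card_sdiff_of_subset]
  · rw [card_powersetCard_filter_mem k hk _ j (mem_compl.mpr hj.2),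
      card_powersetCard_filter_mem k hk _ j
        (mem_sdiff.mpr ⟨mem_compl.mpr hj.2, notMem_erase j Y⟩), card_compl, hA]
    refine Nat.sub_le_sub_left (Nat.choose_le_choose _ ?_) _
    have h1 := le_card_sdiff (Y.erase j) Aᶜ
    have h2 : (Y.erase j).card ≤ Y.card := card_le_card (erase_subset _ _)
    rw [card_compl, hA] at h1
    omega
  · refine filter_subset_filter _ (powersetCard_mono sdiff_subset)

/-- A set through j in T that is left out of the family has no point of Y other than possibly j, so
it lies in the complement of `Y.erase j`. -/
theorem card_hits_sub_card_crossFamily_le (k : ℕ) (hk : 1 ≤ k) {T Y : Finset α} :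
    ((layer α k).filter (fun A => ¬ Disjoint A T)).card
      ≤ (crossFamily k T Y).card + T.card * (Fintype.card α - Y.card).choose (k - 1) := by
  have hsub : (layer α k).filter (fun A => ¬ Disjoint A T)
      ⊆ crossFamily k T Y ∪ T.biUnion
        (fun j => ((Y.erase j)ᶜ.powersetCard k).filter (fun A => j ∈ A)) := by
    intro A hA
    rw [mem_filter] at hA
    rw [mem_union, or_iff_not_imp_left]
    intro hnot
    obtain ⟨j, hj, hjT⟩ := not_disjoint_iff.mp hA.2
    rw [mem_biUnion]
    refine ⟨j, hjT, mem_filter.mpr ⟨mem_powersetCard.mpr ⟨fun w hw => ?_, mem_layer.mp hA.1⟩, hj⟩⟩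
    rw [mem_compl, mem_erase]
    rintro ⟨hne, hwY⟩
    exact hnot (mem_filter.mpr ⟨hA.1, j, hj, hjT, w, hw, hne, hwY⟩)
  refine (card_le_card hsub).trans ((card_union_le _ _).trans (Nat.add_le_add_left
    (card_biUnion_le_card_mul _ _ _ fun j _ => ?_) _))
  rw [card_powersetCard_filter_mem k hk _ j (mem_compl.mpr (notMem_erase j Y)), card_compl]
  refine Nat.choose_le_choose _ ?_
  have := pred_card_le_card_erase (s := Y) (a := j)
  omega

/-- With one point in Y the family is too small, which later forces Y to have at least two points.
-/
theorem card_crossFamily_singleton_le (k : ℕ) (hk : k ≤ Fintype.card α) {T : Finset α} {w : α} :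
    (crossFamily k T {w}).card
      ≤ T.card * (Fintype.card α - 2).choose (Fintype.card α - k) := by
  have hsub : crossFamily k T {w}
      ⊆ (T.erase w).biUnion (fun j => (layer α k).filter (fun A => {j, w} ⊆ A)) := by
    intro A hA
    rw [crossFamily, mem_filter] at hA
    obtain ⟨hk, j, hj, hjT, v, hv, hne, hvw⟩ := hA
    rw [mem_singleton] at hvw
    subst hvw
    exact mem_biUnion.mpr ⟨j, mem_erase.mpr ⟨hne.symm, hjT⟩,
      mem_filter.mpr ⟨hk, by simp [insert_subset_iff, hj, hv]⟩⟩
  refine (card_le_card hsub).trans ((card_biUnion_le_card_mul _ _ _ fun j hj => ?_).trans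
    (Nat.mul_le_mul_right _ (card_le_card (erase_subset w T))))
  rw [card_layer_filter_superset k hk, card_pair (mem_erase.mp hj).1]

theorem card_layer_hits (k : ℕ) (T : Finset α) :
    ((layer α k).filter (fun A => ¬ Disjoint A T)).card
      = (Fintype.card α).choose k - (Fintype.card α - T.card).choose k := by
  have h1 : ((layer α k).filter (fun A => Disjoint A T)).card
      = (Fintype.card α - T.card).choose k := by
    rw [← card_compl, ← card_powersetCard]
    congr 1
    ext A
    rw [mem_filter, mem_layer, mem_powersetCard, subset_compl_iff_disjoint_right]
    tauto
  have h2 := card_filter_add_card_filter_not (s := layer α k) (fun A => Disjoint A T)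
  rw [h1, card_powersetCard, card_univ] at h2
  omega

end Construction

/-! ### From families of vertices to families of finite sets; existence of the competitor. -/

section Conversion

variable {n k : ℕ}

/-- The underlying family of finite sets. -/
def underlying (F : Finset (KSet n k)) : Finset (Finset (Fin n)) := F.image Subtype.val

theorem mem_underlying {F : Finset (KSet n k)} {A : KSet n k} : A.1 ∈ underlying F ↔ A ∈ F := by
  rw [underlying, mem_image]
  exact ⟨fun ⟨B, hB, h⟩ => Subtype.ext h ▸ hB, fun h => ⟨A, h, rfl⟩⟩

theorem card_underlying (F : Finset (KSet n k)) : (underlying F).card = F.card :=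
  card_image_of_injective _ Subtype.val_injective

theorem underlying_subset (F : Finset (KSet n k)) : underlying F ⊆ layer (Fin n) k := by
  intro A hA
  rw [underlying, mem_image] at hA
  obtain ⟨B, -, rfl⟩ := hA
  exact mem_layer.mpr B.2

theorem exists_underlying_eq {G : Finset (Finset (Fin n))} (hG : G ⊆ layer (Fin n) k) :
    ∃ F : Finset (KSet n k), underlying F = G := by
  refine ⟨univ.filter (fun A => A.1 ∈ G), ?_⟩
  ext A
  rw [underlying, mem_image]
  constructor
  · rintro ⟨B, hB, rfl⟩
    exact (mem_filter.mp hB).2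
  · intro hA
    exact ⟨⟨A, mem_layer.mp (hG hA)⟩, mem_filter.mpr ⟨mem_univ _, hA⟩, rfl⟩

theorem card_familyTrace_singleton (F : Finset (KSet n k)) (x : Fin n) :
    ((familyTrace F {x} {x}).card : ℝ) = pointDegree (underlying F) x := by
  rw [familyTrace, pointDegree]
  congr 1
  have h : ∀ A : KSet n k, A.1 ∩ {x} = {x} ↔ x ∈ A.1 := by
    intro A; rw [inter_eq_right, singleton_subset_iff]
  rw [card_image_of_injOn]
  · rw [underlying, filter_image, card_image_of_injective _ Subtype.val_injective]
    simp only [h]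
  · intro A hA B hB hAB
    rw [mem_coe, mem_filter, h] at hA hB
    simp only [sdiff_singleton_eq_erase] at hAB
    apply Subtype.ext
    rw [← insert_erase hA.2, ← insert_erase hB.2, hAB]

open Classical in
theorem degree_induce_kneserGraph (hk : 1 ≤ k) (F : Finset (KSet n k))
    (A : (F : Set (KSet n k))) :
    ((kneserGraph n k).induce (F : Set (KSet n k))).degree A
      = ((underlying F).filter (fun B => Disjoint A.1.1 B)).card := by
  rw [← SimpleGraph.card_neighborFinset_eq_degree]
  refine card_bij (fun B _ => B.1.1) ?_ ?_ ?_
  · intro B hB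
    rw [SimpleGraph.mem_neighborFinset] at hB
    exact mem_filter.mpr ⟨mem_underlying.mpr B.2, hB.2⟩
  · intro B _ C _ h
    exact Subtype.ext (Subtype.ext h)
  · intro B hB
    rw [mem_filter, underlying, mem_image] at hB
    obtain ⟨⟨C, hC, rfl⟩, hd⟩ := hB
    refine ⟨⟨C, hC⟩, ?_, rfl⟩
    rw [SimpleGraph.mem_neighborFinset]
    refine ⟨?_, hd⟩
    -- A set disjoint from itself would be empty, contrary to k ≥ 1; hence the inequality in the
    -- adjacency is automatic.
    rintro h
    have h2 : A.1.1 = C.1 := congrArg Subtype.val h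
    rw [← h2, disjoint_self, bot_eq_empty, ← card_eq_zero, A.1.2] at hd
    omega

theorem card_disjoint_le_familyMaxDegree (hk : 1 ≤ k) (F : Finset (KSet n k))
    {A : Finset (Fin n)} (hA : A ∈ underlying F) :
    ((underlying F).filter (fun B => Disjoint A B)).card ≤ familyMaxDegree F := by
  classical
  rw [underlying, mem_image] at hA
  obtain ⟨B, hB, rfl⟩ := hA
  rw [← degree_induce_kneserGraph hk F ⟨B, hB⟩, familyMaxDegree]
  exact SimpleGraph.degree_le_maxDegree _ _

theorem familyMaxDegree_le (hk : 1 ≤ k) (F : Finset (KSet n k)) (d : ℕ)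
    (h : ∀ A ∈ underlying F, ((underlying F).filter (fun B => Disjoint A B)).card ≤ d) :
    familyMaxDegree F ≤ d := by
  classical
  rw [familyMaxDegree]
  refine SimpleGraph.maxDegree_le_of_forall_degree_le _ _ fun A => ?_
  rw [degree_induce_kneserGraph hk F A]
  exact h _ (mem_underlying.mpr A.2)

theorem IsUnionOfStars.exists_underlying_eq {s : ℕ} {F : Finset (KSet n k)}
    (h : IsUnionOfStars s F) : ∃ S : Finset (Fin n), S.card = s ∧
      underlying F = (layer (Fin n) k).filter (fun A => ¬ Disjoint A S) := by
  obtain ⟨S, hS, rfl⟩ := h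
  refine ⟨S, hS, ?_⟩
  ext A
  rw [mem_filter, mem_layer, underlying, mem_image]
  constructor
  · rintro ⟨B, hB, rfl⟩
    rw [mem_biUnion] at hB
    obtain ⟨i, hi, hB⟩ := hB
    exact ⟨B.2, not_disjoint_iff.mpr ⟨i, (mem_filter.mp hB).2, hi⟩⟩
  · rintro ⟨hA, hd⟩
    obtain ⟨i, hiA, hi⟩ := not_disjoint_iff.mp hd
    exact ⟨⟨A, hA⟩, mem_biUnion.mpr ⟨i, hi, mem_filter.mpr ⟨mem_univ _, hiA⟩⟩, rfl⟩

theorem isUnionOfStars_of_underlying_eq {s : ℕ} {F : Finset (KSet n k)} {S : Finset (Fin n)}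
    (hS : S.card = s)
    (h : underlying F = (layer (Fin n) k).filter (fun A => ¬ Disjoint A S)) :
    IsUnionOfStars s F := by
  refine ⟨S, hS, ?_⟩
  ext A
  rw [← mem_underlying, h, mem_filter, mem_layer, not_disjoint_iff, mem_biUnion]
  constructor
  · rintro ⟨-, i, hiA, hi⟩
    exact ⟨i, hi, mem_filter.mpr ⟨mem_univ _, hiA⟩⟩
  · rintro ⟨i, hi, hA⟩
    exact ⟨A.2, i, (mem_filter.mp hA).2, hi⟩

/-- A family of prescribed size of small maximum degree which is not a union of `s` stars. -/
theorem exists_family_small_maxDegree {s : ℕ} (hk : 2 ≤ k) (hn : k + s + 2 ≤ n) (m : ℕ)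
    (hm : (s + 1) * (n - 2).choose (n - k) < m)
    (hm2 : m ≤ n.choose k - (n - (s + 1)).choose k) :
    ∃ (G : Finset (KSet n k)) (b : ℕ), 2 ≤ b ∧ b ≤ n ∧ G.card = m ∧ ¬ IsUnionOfStars s G ∧
      familyMaxDegree G ≤ s * ((n - k - 1).choose (k - 1) - (n - k - 1 - b).choose (k - 1)) ∧
      n.choose k - (n - (s + 1)).choose k ≤ m + (s + 1) * (n + 1 - b).choose (k - 1) := by
  set T : Finset (Fin n) := univ.filter (fun x => x.val < s + 1) with hT
  -- T consists of the first s+1 points and Y y of the last y, so the sets Y y are nested and the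
  -- last point w lies outside T.
  set Y : ℕ → Finset (Fin n) := fun y => univ.filter (fun x => n - y ≤ x.val) with hY
  have hTc : T.card = s + 1 := by
    rw [hT, Fin.card_filter_val_lt]; omega
  have hYc : ∀ y ≤ n, (Y y).card = y := by
    intro y hy
    have h1 := card_filter_add_card_filter_not (s := (univ : Finset (Fin n)))
      (fun x => x.val < n - y)
    rw [Fin.card_filter_val_lt, card_univ, Fintype.card_fin] at h1
    simp only [not_lt] at h1
    have h2 : (Y y).card = _ := rfl
    rw [hY] at h2 ⊢
    simp only at h2 ⊢
    omega
  have hYmono : ∀ y z, y ≤ z → Y y ⊆ Y z := by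
    intro y z hyz x hx
    rw [hY, mem_filter] at hx ⊢
    exact ⟨mem_univ _, by omega⟩
  have hYn : Y n = univ := by
    ext x; simp [hY]
  have hall : ((layer (Fin n) k).filter (fun A => ¬ Disjoint A T)).card
      = n.choose k - (n - (s + 1)).choose k := by
    rw [card_layer_hits, hTc, Fintype.card_fin]
  have hex : ∃ y, m ≤ (crossFamily k T (Y y)).card := by
    refine ⟨n, ?_⟩
    rw [hYn, crossFamily_univ k hk, hall]; exact hm2
  set w : Fin n := ⟨n - 1, by omega⟩ with hw
  have hY1 : Y 1 = {w} := by
    ext x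
    rw [hY, mem_filter, mem_singleton, Fin.ext_iff]
    have := x.2
    simp only [mem_univ, true_and, hw]
    omega
  classical
  -- The least b for which the cross family has at least m members. The competitor is placed between
  -- the families for b-1 and b: the larger bounds its degrees, the smaller bounds what is missing
  -- from the s+1 stars.
  set b := Nat.find hex with hb
  have hbspec : m ≤ (crossFamily k T (Y b)).card := Nat.find_spec hex
  have hbn : b ≤ n := by
    refine Nat.find_min' hex ?_
    rw [hYn, crossFamily_univ k hk, hall]; exact hm2
  have hb2 : 2 ≤ b := by
    by_contra hlt
    have h1 : crossFamily k T (Y b) ⊆ crossFamily k T (Y 1) :=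
      crossFamily_mono k T (hYmono _ _ (by omega))
    have h2 := card_le_card h1
    rw [hY1] at h2
    have h3 := card_crossFamily_singleton_le k (by rw [Fintype.card_fin]; omega) (T := T) (w := w)
    rw [hTc, Fintype.card_fin] at h3
    omega
  have hbpred : (crossFamily k T (Y (b - 1))).card < m := by
    have := Nat.find_min hex (show b - 1 < b by omega)
    omega
  obtain ⟨G, hG1, hG2, hGc⟩ := exists_subsuperset_card_eq
    (crossFamily_mono k T (hYmono (b - 1) b (by omega))) hbpred.le hbspec
  have hGl : G ⊆ layer (Fin n) k :=
    (hG2.trans (crossFamily_subset _ _ _)).trans (filter_subset _ _)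
  obtain ⟨G', hG'⟩ := _root_.exists_underlying_eq hGl
  refine ⟨G', b, hb2, hbn, by rw [← card_underlying, hG', hGc], ?_, ?_, ?_⟩
  -- Were G all sets hitting S with |S| = s, then S ⊆ T, because G has no member avoiding T. So S
  -- misses some j in T, and a k-set through j and w avoiding S belongs to G, since b ≥ 2 gives Y 1
  -- ⊆ Y (b - 1).
  · intro hU
    obtain ⟨S, hS, hGS⟩ := hU.exists_underlying_eq
    rw [hG'] at hGS
    have hST : S ⊆ T := by
      intro x hx
      by_contra hxT
      have hsub : ({x} : Finset (Fin n)) ⊆ Tᶜ := by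
        rw [singleton_subset_iff, mem_compl]; exact hxT
      obtain ⟨A, hA1, hA2, hA3⟩ := exists_subsuperset_card_eq hsub
        (n := k) (by rw [card_singleton]; omega)
        (by rw [card_compl, hTc, Fintype.card_fin]; omega)
      have hAG : A ∈ G := by
        rw [hGS, mem_filter, mem_layer]
        exact ⟨hA3, not_disjoint_iff.mpr ⟨x, singleton_subset_iff.mp hA1, hx⟩⟩
      have := (mem_filter.mp (crossFamily_subset _ _ _ (hG2 hAG))).2
      exact this (subset_compl_iff_disjoint_right.mp hA2)
    have hlt : S.card < T.card := by omega
    obtain ⟨j, hjT, hjS⟩ := exists_mem_notMem_of_card_lt_card hlt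
    have hwT : w ∉ T := by
      rw [hT, mem_filter]
      simp only [hw]
      omega
    have hwj : w ≠ j := fun h => hwT (h ▸ hjT)
    have hsub : ({j, w} : Finset (Fin n)) ⊆ Sᶜ := by
      intro x hx
      rw [mem_insert, mem_singleton] at hx
      rw [mem_compl]
      rcases hx with rfl | rfl
      · exact hjS
      · exact fun h => hwT (hST h)
    obtain ⟨A, hA1, hA2, hA3⟩ := exists_subsuperset_card_eq hsub
      (n := k) (by rw [card_pair hwj.symm]; omega)
      (by rw [card_compl, hS, Fintype.card_fin]; omega)
    have hAG : A ∈ G := by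
      refine hG1 (crossFamily_mono k T (hYmono 1 (b - 1) (by omega)) ?_)
      rw [hY1, mem_crossFamily]
      exact ⟨hA3, j, hA1 (by simp), hjT, w, hA1 (by simp), hwj, mem_singleton_self w⟩
    rw [hGS, mem_filter] at hAG
    exact hAG.2 (subset_compl_iff_disjoint_right.mp hA2)
  · refine familyMaxDegree_le (by omega) G' _ fun A hA => ?_
    rw [hG'] at hA ⊢
    have hAm := mem_filter.mp (crossFamily_subset _ _ _ (hG2 hA))
    have h1 := card_crossFamily_disjoint_le k (by omega) (Y := Y b) hTc (mem_layer.mp hAm.1) hAm.2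
    rw [hYc b hbn, Fintype.card_fin] at h1
    exact (card_le_card (filter_subset_filter _ hG2)).trans h1
  · have h1 := card_hits_sub_card_crossFamily_le k (by omega) (T := T) (Y := Y (b - 1))
    rw [hall, hTc, hYc (b - 1) (by omega), Fintype.card_fin] at h1
    have h2 : n - (b - 1) = n + 1 - b := by omega
    rw [h2] at h1
    omega

end Conversion

/-! ### Binomial coefficient estimates. -/

section Estimates

/-- Factors are replaced one at a time; each replacement costs at most δ, and the other r-1 factors
are at most ζ. -/
theorem prod_sub_prod_le (x z : ℕ → ℝ) (δ ζ : ℝ) (r : ℕ) (hδ : 0 ≤ δ) (hζ : 0 ≤ ζ)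
    (h : ∀ i < r, 0 ≤ x i ∧ x i ≤ z i ∧ z i ≤ ζ ∧ z i - x i ≤ δ) :
    ∏ i ∈ range r, z i - ∏ i ∈ range r, x i ≤ r * δ * ζ ^ (r - 1) := by
  induction r with
  | zero => simp
  | succ r ih =>
    have ih' := ih fun i hi => h i (by omega)
    obtain ⟨h0, h1, h2, h3⟩ := h r (by omega)
    rw [prod_range_succ, prod_range_succ, Nat.add_sub_cancel]
    have hz : ∏ i ∈ range r, z i ≤ ζ ^ r := by
      calc ∏ i ∈ range r, z i ≤ ∏ _i ∈ range r, ζ := prod_le_prod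
            (fun i hi => (h i (by simp at hi; omega)).1.trans (h i (by simp at hi; omega)).2.1)
            (fun i hi => (h i (by simp at hi; omega)).2.2.1)
        _ = ζ ^ r := by simp
    have hz0 : 0 ≤ ∏ i ∈ range r, z i := prod_nonneg fun i hi =>
      (h i (by simp at hi; omega)).1.trans (h i (by simp at hi; omega)).2.1
    have e1 : (∏ i ∈ range r, z i) * (z r - x r) ≤ ζ ^ r * δ :=
      mul_le_mul hz h3 (by linarith) (by positivity)
    have e2 : (∏ i ∈ range r, z i - ∏ i ∈ range r, x i) * x r ≤ r * δ * ζ ^ r := by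
      have e3 : (r : ℝ) * δ * ζ ^ (r - 1) * ζ = r * δ * ζ ^ r := by
        rcases r with _ | r
        · simp
        · rw [Nat.add_sub_cancel, pow_succ]; ring
      calc _ ≤ (r : ℝ) * δ * ζ ^ (r - 1) * x r := mul_le_mul_of_nonneg_right ih' h0
        _ ≤ (r : ℝ) * δ * ζ ^ (r - 1) * ζ :=
            mul_le_mul_of_nonneg_left (h1.trans h2) (by positivity)
        _ = _ := e3
    push_cast
    nlinarith

/-- Bernoulli bounds rw by (1+w)^(r-1), and (1+w)(1-w) ≤ 1. This absorbs the factor kw in the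
product comparison, keeping its error at order k/n instead of k²/n. -/
theorem mul_one_sub_pow_le_one (r : ℕ) (hr : 1 ≤ r) (w : ℝ) (h0 : 0 ≤ w) (h1 : w ≤ 1) :
    r * w * (1 - w) ^ (r - 1) ≤ 1 := by
  obtain ⟨q, rfl⟩ := Nat.exists_eq_add_of_le' hr
  rw [Nat.add_sub_cancel]
  have hb := one_add_mul_le_pow (by linarith : (-2 : ℝ) ≤ w) q
  have hp : (0 : ℝ) ≤ (1 - w) ^ q := pow_nonneg (by linarith) _
  calc ((q + 1 : ℕ) : ℝ) * w * (1 - w) ^ q ≤ (1 + w) ^ q * (1 - w) ^ q := by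
        refine mul_le_mul_of_nonneg_right (le_trans ?_ hb) hp
        push_cast; linarith
    _ = (1 - w ^ 2) ^ q := by rw [← mul_pow]; ring_nf
    _ ≤ 1 := pow_le_one₀ (by nlinarith) (by nlinarith)

theorem choose_div_choose_eq_prod (m a r : ℕ) (hr : r ≤ m) :
    (a.choose r : ℝ) / m.choose r = ∏ i ∈ range r, ((a - i : ℕ) : ℝ) / ((m - i : ℕ) : ℝ) := by
  rw [prod_div_distrib]
  have h1 : ∀ b : ℕ, ∏ i ∈ range r, ((b - i : ℕ) : ℝ) = (r.factorial : ℝ) * b.choose r := by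
    intro b
    rw [← Nat.cast_prod, ← Nat.descFactorial_eq_prod_range,
      Nat.descFactorial_eq_factorial_mul_choose]
    push_cast; ring
  rw [h1, h1]
  have : (0 : ℝ) < r.factorial := by positivity
  have h2 : (0 : ℝ) < m.choose r := by exact_mod_cast Nat.choose_pos hr
  field_simp

/-- Comparison of the densities of sets avoiding `b` points in two ground sets whose sizes differ
by `k`. -/
theorem choose_ratio_comparison (n k b : ℕ) (hk : 2 ≤ k) (hn : 100 * k ≤ n) (hb2 : 2 ≤ b)
    (hbn : b ≤ n) :
    ((n + 1 - b).choose (k - 1) : ℝ) / (n - 1).choose (k - 1) - 4 * (k / n)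
      ≤ ((n - k - 1 - b).choose (k - 1) : ℝ) / (n - k - 1).choose (k - 1) := by
  rw [choose_div_choose_eq_prod _ _ _ (by omega), choose_div_choose_eq_prod _ _ _ (by omega)]
  have hnR : (100 : ℝ) * k ≤ n := by exact_mod_cast hn
  have hkR : (2 : ℝ) ≤ k := by exact_mod_cast hk
  have hb2R : (2 : ℝ) ≤ b := by exact_mod_cast hb2
  have hbnR : (b : ℝ) ≤ n := by exact_mod_cast hbn
  have hn1 : (0 : ℝ) < (n : ℝ) - 1 := by linarith
  have hn0 : (0 : ℝ) < (n : ℝ) := by linarith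
  -- Factors of the larger ratio are 1 - (b-2)/(n-1-i), or zero by truncation, so the one at i = 0
  -- is the largest and 1 - w bounds them all.
  set w : ℝ := ((b : ℝ) - 2) / ((n : ℝ) - 1) with hw
  have hw0 : 0 ≤ w := div_nonneg (by linarith) hn1.le
  have hw1 : w ≤ 1 := by rw [hw, div_le_one hn1]; linarith
  have hwb : w * ((n : ℝ) - 1) = (b : ℝ) - 2 := by rw [hw]; field_simp
  -- Untruncated factors differ by (2 + k(b-2)/(n-1-i))/(n-k-1-i). As i < k and n ≥ 100k, the
  -- denominator is at least 0.9n and (b-2)/(n-1-i) ≤ 1.2w. The final constant is 3.2/0.9 < 4.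
  set δ : ℝ := (2 + 1.2 * (k * w)) / (0.9 * n) with hδ
  have hδ0 : 0 ≤ δ := by positivity
  have key := prod_sub_prod_le (fun i => ((n - k - 1 - b - i : ℕ) : ℝ) / ((n - k - 1 - i : ℕ) : ℝ))
    (fun i => ((n + 1 - b - i : ℕ) : ℝ) / ((n - 1 - i : ℕ) : ℝ)) δ (1 - w) (k - 1) hδ0
    (by linarith) (fun i hi => ?_)
  · have hr : (((k - 1 : ℕ) : ℝ)) * δ * (1 - w) ^ (k - 1 - 1) ≤ 4 * (k / n) := by
      have h1 := mul_one_sub_pow_le_one (k - 1) (by omega) w hw0 hw1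
      have h2 : (1 - w) ^ (k - 1 - 1) ≤ 1 := pow_le_one₀ (by linarith) (by linarith)
      have h3 : (0 : ℝ) ≤ (1 - w) ^ (k - 1 - 1) := pow_nonneg (by linarith) _
      have h4 : ((k - 1 : ℕ) : ℝ) ≤ k := by exact_mod_cast Nat.sub_le k 1
      have h5 : ((k - 1 : ℕ) : ℝ) * (1 - w) ^ (k - 1 - 1) ≤ k * 1 :=
        mul_le_mul h4 h2 h3 (by linarith)
      calc (((k - 1 : ℕ) : ℝ)) * δ * (1 - w) ^ (k - 1 - 1)
          = (2 * (((k - 1 : ℕ) : ℝ) * (1 - w) ^ (k - 1 - 1))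
            + 1.2 * k * (((k - 1 : ℕ) : ℝ) * w * (1 - w) ^ (k - 1 - 1))) / (0.9 * n) := by
              rw [hδ]; ring
        _ ≤ (2 * (k * 1) + 1.2 * k * 1) / (0.9 * n) := by gcongr
        _ ≤ 4 * (k / n) := by
            rw [← mul_div_assoc, div_le_div_iff₀ (by positivity) hn0]
            nlinarith
    linarith
  · have hiR : (i : ℝ) + 2 ≤ k := by exact_mod_cast (by omega : i + 2 ≤ k)
    have hi0 : (0 : ℝ) ≤ i := Nat.cast_nonneg i
    have hm1 : ((n - k - 1 - i : ℕ) : ℝ) = (n : ℝ) - k - 1 - i := by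
      rw [Nat.cast_sub (by omega), Nat.cast_sub (by omega), Nat.cast_sub (by omega)]; simp
    have hm2 : ((n - 1 - i : ℕ) : ℝ) = (n : ℝ) - 1 - i := by
      rw [Nat.cast_sub (by omega), Nat.cast_sub (by omega)]; simp
    have p1 : (0 : ℝ) < (n : ℝ) - k - 1 - i := by linarith
    have p2 : (0 : ℝ) < (n : ℝ) - 1 - i := by linarith
    have c1 : ((n - k - 1 - b - i : ℕ) : ℝ) = max ((n : ℝ) - k - 1 - b - i) 0 := by
      rcases le_total (k + 1 + b + i) n with h | h
      · rw [max_eq_left]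
        · rw [Nat.cast_sub (by omega), Nat.cast_sub (by omega), Nat.cast_sub (by omega),
            Nat.cast_sub (by omega)]; simp
        · have : (k : ℝ) + 1 + b + i ≤ n := by exact_mod_cast h
          linarith
      · rw [max_eq_right]
        · rw [Nat.cast_eq_zero]; omega
        · have : (n : ℝ) ≤ (k : ℝ) + 1 + b + i := by exact_mod_cast h
          linarith
    have c2 : ((n + 1 - b - i : ℕ) : ℝ) = max ((n : ℝ) + 1 - b - i) 0 := by
      rcases le_total (b + i) (n + 1) with h | h
      · rw [max_eq_left]
        · rw [Nat.cast_sub (by omega), Nat.cast_sub (by omega)]; push_cast; ring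
        · have : (b : ℝ) + i ≤ n + 1 := by exact_mod_cast h
          linarith
      · rw [max_eq_right]
        · rw [Nat.cast_eq_zero]; omega
        · have : (n : ℝ) + 1 ≤ b + i := by exact_mod_cast h
          linarith
    simp only [hm1, hm2, c1, c2]
    have q1 : ((n : ℝ) - k - 1 - b - i) / ((n : ℝ) - k - 1 - i)
        = 1 - b / ((n : ℝ) - k - 1 - i) := by
      rw [eq_sub_iff_add_eq, ← add_div, div_eq_one_iff_eq p1.ne']; ring
    have q2 : ((n : ℝ) + 1 - b - i) / ((n : ℝ) - 1 - i) = 1 - (b - 2) / ((n : ℝ) - 1 - i) := by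
      rw [eq_sub_iff_add_eq, ← add_div, div_eq_one_iff_eq p2.ne']; ring
    rw [← max_div_div_right p1.le, ← max_div_div_right p2.le, q1, q2, zero_div, zero_div]
    have hxz : ((b : ℝ) - 2) / ((n : ℝ) - 1 - i) ≤ b / ((n : ℝ) - k - 1 - i) :=
      div_le_div₀ (by linarith) (by linarith) p1 (by linarith)
    have hzw : w ≤ ((b : ℝ) - 2) / ((n : ℝ) - 1 - i) :=
      div_le_div_of_nonneg_left (by linarith) p2 (by linarith)
    have hdiff : (b : ℝ) / ((n : ℝ) - k - 1 - i) - ((b : ℝ) - 2) / ((n : ℝ) - 1 - i) ≤ δ := by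
      have e : (b : ℝ) / ((n : ℝ) - k - 1 - i) - ((b : ℝ) - 2) / ((n : ℝ) - 1 - i)
          = (2 + k * (((b : ℝ) - 2) / ((n : ℝ) - 1 - i))) / ((n : ℝ) - k - 1 - i) := by
        field_simp; ring
      rw [e, hδ]
      have h6 : ((b : ℝ) - 2) / ((n : ℝ) - 1 - i) ≤ 1.2 * w := by
        rw [div_le_iff₀ p2]; nlinarith
      refine div_le_div₀ (by positivity) ?_ (by positivity) (by linarith)
      nlinarith
    refine ⟨le_max_right _ _, max_le_max (by linarith) le_rfl, max_le (by linarith) (by linarith),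
      ?_⟩
    rw [sub_le_iff_le_add]
    refine max_le ?_ ?_
    · have := le_max_left (1 - (b : ℝ) / ((n : ℝ) - k - 1 - i)) 0
      linarith
    · have := le_max_right (1 - (b : ℝ) / ((n : ℝ) - k - 1 - i)) 0
      linarith

theorem choose_sub_choose_le (m t r : ℕ) (ht : t ≤ m) (hr : 1 ≤ r) :
    (m.choose r : ℝ) - (m - t).choose r ≤ t * (m - 1).choose (r - 1) := by
  induction t with
  | zero => simp
  | succ t ih =>
    have h1 := ih (by omega)
    have h2 : (m - t).choose r = (m - (t + 1)).choose (r - 1) + (m - (t + 1)).choose r := by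
      have e1 : m - t = (m - (t + 1)) + 1 := by omega
      obtain ⟨q, rfl⟩ := Nat.exists_eq_add_of_le' hr
      rw [e1, Nat.choose_succ_succ, Nat.add_sub_cancel]
    have h3 : (m - (t + 1)).choose (r - 1) ≤ (m - 1).choose (r - 1) :=
      Nat.choose_le_choose _ (by omega)
    have h2R : ((m - t).choose r : ℝ) = (m - (t + 1)).choose (r - 1) + (m - (t + 1)).choose r := by
      exact_mod_cast h2
    have h3R : ((m - (t + 1)).choose (r - 1) : ℝ) ≤ (m - 1).choose (r - 1) := by exact_mod_cast h3
    push_cast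
    linarith

theorem le_choose_sub_choose (m t r : ℕ) (ht : t ≤ m) (hr : 1 ≤ r) :
    (t : ℝ) * (m - t).choose (r - 1) ≤ (m.choose r : ℝ) - (m - t).choose r := by
  induction t with
  | zero => simp
  | succ t ih =>
    have h1 := ih (by omega)
    have h2 : (m - t).choose r = (m - (t + 1)).choose (r - 1) + (m - (t + 1)).choose r := by
      have e1 : m - t = (m - (t + 1)) + 1 := by omega
      obtain ⟨q, rfl⟩ := Nat.exists_eq_add_of_le' hr
      rw [e1, Nat.choose_succ_succ, Nat.add_sub_cancel]
    have h3 : (m - (t + 1)).choose (r - 1) ≤ (m - t).choose (r - 1) :=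
      Nat.choose_le_choose _ (by omega)
    have h2R : ((m - t).choose r : ℝ) = (m - (t + 1)).choose (r - 1) + (m - (t + 1)).choose r := by
      exact_mod_cast h2
    have h3R : ((m - (t + 1)).choose (r - 1) : ℝ) ≤ (m - t).choose (r - 1) := by exact_mod_cast h3
    have h4 := mul_le_mul_of_nonneg_left h3R (Nat.cast_nonneg (α := ℝ) t)
    push_cast
    linarith

theorem choose_mul_eq (m r : ℕ) (hm : 1 ≤ m) (hr : 1 ≤ r) :
    (m : ℝ) * (m - 1).choose (r - 1) = r * m.choose r := by
  obtain ⟨m, rfl⟩ := Nat.exists_eq_add_of_le' hm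
  obtain ⟨r, rfl⟩ := Nat.exists_eq_add_of_le' hr
  have := Nat.add_one_mul_choose_eq m r
  have h := congrArg (Nat.cast (R := ℝ)) this
  simp only [Nat.add_sub_cancel]
  push_cast at h ⊢
  linarith

/-- Bernoulli-type bound for binomial coefficients. -/
theorem choose_sub_ge (m t r : ℕ) (ht : t ≤ m) (hm : 1 ≤ m) (hr : 1 ≤ r) :
    (m.choose r : ℝ) * (1 - t * r / m) ≤ (m - t).choose r := by
  have h1 := choose_sub_choose_le m t r ht hr
  have h2 := choose_mul_eq m r hm hr
  have hm' : (0 : ℝ) < m := by exact_mod_cast hm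
  have h3 : ((m - 1).choose (r - 1) : ℝ) = r * m.choose r / m := by rw [← h2]; field_simp
  rw [h3] at h1
  have : (m.choose r : ℝ) * (1 - t * r / m) = m.choose r - t * (r * m.choose r / m) := by ring
  linarith

end Estimates

/-! ### Comparison of the two bounds. -/

section Assembly

variable {n k s : ℕ}

theorem mul_le_two_mul_of_hundred (hk : 2 ≤ k) (hs : 1 ≤ s) (hn : 100 * s ^ 2 * k ≤ n) :
    100 * k ≤ n ∧ k + s + 2 ≤ n ∧ (s + 1) * (k + 1) ≤ 2 * n ∧ (s + 1) * k < n := by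
  have h1 : s ≤ s ^ 2 := by nlinarith
  have h2 : s * k ≤ s ^ 2 * k := Nat.mul_le_mul_right _ h1
  have h3 : k ≤ s * k := Nat.le_mul_of_pos_left _ hs
  have h4 : s ≤ s * k := Nat.le_mul_of_pos_right _ (by omega)
  have h5 : 100 * (s ^ 2 * k) ≤ n := by rw [← mul_assoc]; exact hn
  refine ⟨by omega, by omega, ?_, ?_⟩
  · nlinarith
  · nlinarith

/-- Degree of a `k`-set into a union of `s` stars whose centres it avoids. -/
theorem degree_into_stars_ge (hk : 2 ≤ k) (hs : 1 ≤ s) (hn : 100 * s ^ 2 * k ≤ n) :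
    ((n - k - 1).choose (k - 1) : ℝ) * (s - (s ^ 2 + s) * (k / n))
      ≤ (n - k).choose k - (n - k - s).choose k := by
  obtain ⟨g1, g2, g3, -⟩ := mul_le_two_mul_of_hundred hk hs hn
  refine le_trans ?_ (le_choose_sub_choose (n - k) s k (by omega) (by omega))
  have h1 := choose_sub_ge (n - k - 1) (s - 1) (k - 1) (by omega) (by omega) (by omega)
  have e : n - k - 1 - (s - 1) = n - k - s := by omega
  rw [e] at h1
  have hL : (0 : ℝ) ≤ ((n - k - 1).choose (k - 1) : ℝ) := Nat.cast_nonneg _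
  have hs0 : (1 : ℝ) ≤ s := by exact_mod_cast hs
  have hk0 : (2 : ℝ) ≤ k := by exact_mod_cast hk
  have g1' : (100 : ℝ) * k ≤ n := by exact_mod_cast g1
  have g3' : ((s : ℝ) + 1) * (k + 1) ≤ 2 * n := by exact_mod_cast g3
  have c1 : ((s - 1 : ℕ) : ℝ) = s - 1 := by rw [Nat.cast_sub hs]; simp
  have c2 : ((k - 1 : ℕ) : ℝ) = k - 1 := by rw [Nat.cast_sub (by omega)]; simp
  have c3 : ((n - k - 1 : ℕ) : ℝ) = n - k - 1 := by
    rw [Nat.cast_sub (by omega), Nat.cast_sub (by omega)]; simp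
  rw [c1, c2, c3] at h1
  refine le_trans ?_ (mul_le_mul_of_nonneg_left h1 (by linarith : (0 : ℝ) ≤ s))
  have hfrac : (s : ℝ) * ((s - 1) * (k - 1) / (n - k - 1)) ≤ (s ^ 2 + s) * (k / n) := by
    rw [← mul_div_assoc, ← mul_div_assoc, div_le_div_iff₀ (by linarith) (by linarith)]
    have f1 : ((s : ℝ) - 1) * n ≤ (s + 1) * (n - k - 1) := by nlinarith
    have f2 : ((s : ℝ) * (k - 1)) * ((s - 1) * n) ≤ (s * k) * ((s + 1) * (n - k - 1)) :=
      mul_le_mul (by nlinarith) f1 (mul_nonneg (by linarith) (by linarith)) (by positivity)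
    nlinarith
  nlinarith [mul_le_mul_of_nonneg_left hfrac hL]

theorem choose_sub_star_ge (hk : 2 ≤ k) (hs : 1 ≤ s) (hn : 100 * s ^ 2 * k ≤ n) :
    ((n - 1).choose (k - 1) : ℝ) * (1 - s * (k / n)) ≤ (n - s - 1).choose (k - 1) := by
  obtain ⟨g1, g2, -, -⟩ := mul_le_two_mul_of_hundred hk hs hn
  have h1 := choose_sub_ge (n - 1) s (k - 1) (by omega) (by omega) (by omega)
  have e : n - 1 - s = n - s - 1 := by omega
  rw [e] at h1
  refine le_trans (mul_le_mul_of_nonneg_left ?_ (Nat.cast_nonneg _)) h1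
  have hk0 : (2 : ℝ) ≤ k := by exact_mod_cast hk
  have g1' : (100 : ℝ) * k ≤ n := by exact_mod_cast g1
  have c2 : ((k - 1 : ℕ) : ℝ) = k - 1 := by rw [Nat.cast_sub (by omega)]; simp
  have c3 : ((n - 1 : ℕ) : ℝ) = n - 1 := by rw [Nat.cast_sub (by omega)]; simp
  rw [c2, c3, mul_div_assoc]
  have : ((k : ℝ) - 1) / (n - 1) ≤ k / n := by
    rw [div_le_div_iff₀ (by linarith) (by linarith)]; nlinarith
  have := mul_le_mul_of_nonneg_left this (Nat.cast_nonneg (α := ℝ) s)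
  linarith

theorem hundred_mul_density (hk : 2 ≤ k) (hs : 1 ≤ s) (hn : 100 * s ^ 2 * k ≤ n) :
    100 * (s : ℝ) ^ 2 * (k / n) ≤ 1 := by
  obtain ⟨g1, -, -, -⟩ := mul_le_two_mul_of_hundred hk hs hn
  have hn0 : (0 : ℝ) < n := by exact_mod_cast (by omega : 0 < n)
  rw [← mul_div_assoc, div_le_one hn0]
  exact_mod_cast hn

/-- Average contribution of the excess part of a family to the degrees. -/
theorem excess_density_ge (hk : 2 ≤ k) (hs : 1 ≤ s) (hn : 100 * s ^ 2 * k ≤ n) (lam : ℝ)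
    (h1 : (s : ℝ) ≤ lam) (h2 : lam ≤ s + 1) :
    ((n - k - 1).choose (k - 1) : ℝ) * (lam - s - 2 * s * (k / n))
      ≤ (n - k).choose k / n.choose k * ((lam - s) * (n - s - 1).choose (k - 1)) := by
  obtain ⟨g1, g2, -, -⟩ := mul_le_two_mul_of_hundred hk hs hn
  have hC := choose_sub_star_ge hk hs hn
  have m1 := choose_mul_eq (n - k) k (by omega) (by omega)
  have m2 := choose_mul_eq n k (by omega) (by omega)
  have hk0 : (0 : ℝ) < k := by exact_mod_cast (by omega : 0 < k)
  have hs0 : (1 : ℝ) ≤ s := by exact_mod_cast hs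
  have hn0 : (0 : ℝ) < n := by exact_mod_cast (by omega : 0 < n)
  have g1' : (100 : ℝ) * k ≤ n := by exact_mod_cast g1
  rw [Nat.cast_sub (by omega)] at m1
  have hN : (0 : ℝ) < ((n - 1).choose (k - 1) : ℝ) := by
    exact_mod_cast Nat.choose_pos (by omega)
  have hnk : (0 : ℝ) < (n.choose k : ℝ) := by exact_mod_cast Nat.choose_pos (by omega)
  have hL : (0 : ℝ) < ((n - k - 1).choose (k - 1) : ℝ) := by
    exact_mod_cast Nat.choose_pos (by omega)
  set p : ℝ := k / n with hp
  have hp0 : 0 ≤ p := by positivity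
  have hp1 : p ≤ 1 := by rw [hp, div_le_one hn0]; linarith
  -- The identity C(n-k,k)/C(n,k) = (1-p)L/N brings the edge density to the common unit L.
  have hratio : ((n - k).choose k : ℝ) / n.choose k
      = (n - k - 1).choose (k - 1) * (1 - p) / (n - 1).choose (k - 1) := by
    rw [div_eq_div_iff hnk.ne' hN.ne', hp]
    field_simp
    have e1 : ((n - k).choose k : ℝ) = (n - k) * (n - k - 1).choose (k - 1) / k := by
      rw [m1]; field_simp
    have e2 : (n.choose k : ℝ) = n * (n - 1).choose (k - 1) / k := by rw [m2]; field_simp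
    rw [e1, e2]
    field_simp
  rw [hratio]
  have hsub : 0 ≤ lam - s := by linarith
  calc _ ≤ ((n - k - 1).choose (k - 1) : ℝ) * ((1 - p) * ((lam - s) * (1 - s * p))) := by
        refine mul_le_mul_of_nonneg_left ?_ hL.le
        nlinarith [mul_nonneg hp0 (by linarith : (0:ℝ) ≤ s), mul_nonneg hp0 hp0,
          mul_nonneg hsub hp0, mul_nonneg hsub (mul_nonneg hp0 (by linarith : (0:ℝ) ≤ s)),
          mul_nonneg hsub (mul_nonneg (mul_nonneg hp0 hp0) (by linarith : (0:ℝ) ≤ s)),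
          mul_nonneg (by linarith : 0 ≤ 1 - (lam - s)) (mul_nonneg hp0 (by linarith : (0:ℝ) ≤ s)),
          mul_nonneg hsub (mul_nonneg hp0 (by linarith : (0:ℝ) ≤ s - 1))]
    _ = (n - k - 1).choose (k - 1) * (1 - p) / (n - 1).choose (k - 1)
        * ((lam - s) * ((n - 1).choose (k - 1) * (1 - s * p))) := by
        field_simp
    _ ≤ _ := by
        refine mul_le_mul_of_nonneg_left (mul_le_mul_of_nonneg_left hC hsub) ?_
        exact div_nonneg (mul_nonneg hL.le (by linarith)) hN.le

/-- Upper bound for the smallest maximum degree. -/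
theorem maxDegree_upper_estimate (hk : 2 ≤ k) (hs : 1 ≤ s) (hn : 100 * s ^ 2 * k ≤ n) (lam : ℝ)
    (h1 : (s : ℝ) ≤ lam) (h2 : lam ≤ s + 1) (m b d : ℕ) (hb2 : 2 ≤ b) (hbn : b ≤ n)
    (hm : (m : ℝ) = n.choose k - (n - s).choose k + (lam - s) * (n - s - 1).choose (k - 1))
    (hd : d ≤ s * ((n - k - 1).choose (k - 1) - (n - k - 1 - b).choose (k - 1)))
    (hmb : n.choose k - (n - (s + 1)).choose k ≤ m + (s + 1) * (n + 1 - b).choose (k - 1)) :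
    (d : ℝ) ≤ (n - k - 1).choose (k - 1) * (s * lam / (s + 1) + 6 * s * (k / n)) := by
  obtain ⟨g1, g2, -, -⟩ := mul_le_two_mul_of_hundred hk hs hn
  have hC := choose_sub_star_ge hk hs hn
  have hcomp := choose_ratio_comparison n k b hk g1 hb2 hbn
  have hN : (0 : ℝ) < ((n - 1).choose (k - 1) : ℝ) := by
    exact_mod_cast Nat.choose_pos (by omega)
  have hL : (0 : ℝ) < ((n - k - 1).choose (k - 1) : ℝ) := by
    exact_mod_cast Nat.choose_pos (by omega)
  have hdR : (d : ℝ) ≤ s * ((n - k - 1).choose (k - 1) - (n - k - 1 - b).choose (k - 1)) := by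
    have h3 : (n - k - 1 - b).choose (k - 1) ≤ (n - k - 1).choose (k - 1) :=
      Nat.choose_le_choose _ (by omega)
    have := (Nat.cast_le (α := ℝ)).mpr hd
    rwa [Nat.cast_mul, Nat.cast_sub h3] at this
  have hmbR : (n.choose k : ℝ) - (n - s - 1).choose k
      ≤ m + (s + 1) * (n + 1 - b).choose (k - 1) := by
    rw [show n - (s + 1) = n - s - 1 by omega] at hmb
    have h3 : n.choose k ≤ m + (s + 1) * (n + 1 - b).choose (k - 1) + (n - s - 1).choose k := by
      omega
    have := (Nat.cast_le (α := ℝ)).mpr h3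
    push_cast at this
    linarith
  have hpascal : ((n - s).choose k : ℝ)
      = (n - s - 1).choose (k - 1) + (n - s - 1).choose k := by
    have e1 : n - s = (n - s - 1) + 1 := by omega
    have e2 : k = (k - 1) + 1 := by omega
    have := Nat.choose_succ_succ (n - s - 1) (k - 1)
    rw [Nat.succ_eq_add_one, Nat.succ_eq_add_one, ← e1, ← e2] at this
    exact_mod_cast this
  have hs0 : (1 : ℝ) ≤ s := by exact_mod_cast hs
  set N : ℝ := ((n - 1).choose (k - 1) : ℝ) with hNdef
  set L : ℝ := ((n - k - 1).choose (k - 1) : ℝ) with hLdef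
  set p : ℝ := k / n with hp
  have hp0 : 0 ≤ p := by positivity
  -- The competitor lacks β C(n-s-1,k-1) sets of the s+1 stars, so the sets through a centre that
  -- avoid Y have density at least about β/(s+1). The ratio comparison transfers this to the
  -- complement of a k-set, and s(1 - β/(s+1)) = sλ/(s+1).
  set β : ℝ := s + 1 - lam with hβ
  have hβ0 : 0 ≤ β := by linarith
  have hβ1 : β ≤ 1 := by linarith
  have hZ : β * (N * (1 - s * p)) ≤ (s + 1) * (n + 1 - b).choose (k - 1) := by
    have := mul_le_mul_of_nonneg_left hC hβ0
    nlinarith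
  have hZ2 : β * (1 - s * p) / (s + 1) ≤ ((n + 1 - b).choose (k - 1) : ℝ) / N := by
    rw [div_le_div_iff₀ (by linarith) hN]
    linarith
  have hX : L * (β * (1 - s * p) / (s + 1) - 4 * p) ≤ (n - k - 1 - b).choose (k - 1) := by
    have : β * (1 - s * p) / (s + 1) - 4 * p
        ≤ ((n - k - 1 - b).choose (k - 1) : ℝ) / L := by linarith
    rw [le_div_iff₀ hL] at this
    linarith
  have hfin : (s : ℝ) * (1 - (β * (1 - s * p) / (s + 1) - 4 * p))
      ≤ s * lam / (s + 1) + 6 * s * p := by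
    have e : (s : ℝ) * (1 - (β * (1 - s * p) / (s + 1) - 4 * p))
        = s * lam / (s + 1) + 4 * s * p + (s * p) * (β * (s / (s + 1))) := by
      rw [hβ]; field_simp; ring
    have f1 : (s : ℝ) / (s + 1) ≤ 1 := by rw [div_le_one (by linarith)]; linarith
    have f2 : β * ((s : ℝ) / (s + 1)) ≤ 1 := mul_le_one₀ hβ1 (by positivity) f1
    have f3 : 0 ≤ (s : ℝ) * p := by positivity
    rw [e]
    nlinarith
  calc (d : ℝ) ≤ s * (L - (n - k - 1 - b).choose (k - 1)) := hdR
    _ ≤ s * (L - L * (β * (1 - s * p) / (s + 1) - 4 * p)) := by gcongr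
    _ = L * (s * (1 - (β * (1 - s * p) / (s + 1) - 4 * p))) := by ring
    _ ≤ _ := mul_le_mul_of_nonneg_left hfin hL.le

/-- The error terms coming from the spectral bounds. -/
theorem spectral_error_le (hk : 2 ≤ k) (hs : 1 ≤ s) (hn : 100 * s ^ 2 * k ≤ n) (τ h : ℝ)
    (hτ0 : 0 ≤ τ) (hτ1 : τ ≤ 1) (hh0 : 0 ≤ h)
    (hh : h ≤ (s + 1) * (n - 1).choose (k - 1)) (C1 C2 : ℝ)
    (hC1 : C1 = (n - 1).choose (k - 1)) (hC12 : ((n : ℝ) - 1) * C2 = (k - 1) * C1) :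
    (C1 * τ + √(2 * C2 * h)) / (C1 - C2)
      + √(s * (C1 * (k / n) ^ 2 * h / (C1 - C2) ^ 2 + C2 / (C1 - C2)))
      ≤ τ + 2 * (k / n) + 4 * √((s + 1) * (k / n)) := by
  obtain ⟨g1, g2, -, -⟩ := mul_le_two_mul_of_hundred hk hs hn
  have hN : (0 : ℝ) < C1 := by
    rw [hC1]; exact_mod_cast Nat.choose_pos (by omega)
  rw [← hC1] at hh
  have hp100 := hundred_mul_density hk hs hn
  have hk0 : (2 : ℝ) ≤ k := by exact_mod_cast hk
  have hs0 : (1 : ℝ) ≤ s := by exact_mod_cast hs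
  have g1' : (100 : ℝ) * k ≤ n := by exact_mod_cast g1
  have hn0 : (0 : ℝ) < n := by linarith
  set p : ℝ := k / n with hp
  have hp0 : 0 ≤ p := by positivity
  have hpn : p * n = k := by rw [hp]; field_simp
  have hpsm : p ≤ 0.01 := by nlinarith
  have hC2p : C2 ≤ p * C1 := by
    have : ((n : ℝ) - 1) * C2 ≤ (n - 1) * (p * C1) := by
      rw [hC12]
      have : ((k : ℝ) - 1) ≤ (n - 1) * p := by nlinarith
      nlinarith
    exact le_of_mul_le_mul_left this (by linarith)
  have hC20 : 0 ≤ C2 := by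
    have : (0 : ℝ) ≤ (n - 1) * C2 := by
      rw [hC12]; exact mul_nonneg (by linarith) hN.le
    exact nonneg_of_mul_nonneg_right this (by linarith)
  set R : ℝ := C1 - C2 with hR
  have hR0 : (1 - p) * C1 ≤ R := by rw [hR]; linarith
  have hRpos : 0 < R := lt_of_lt_of_le (mul_pos (by linarith) hN) hR0
  have hν : C1 / R ≤ 1 + 2 * p := by
    rw [div_le_iff₀ hRpos]
    nlinarith [mul_nonneg hp0 hN.le]
  have hν0 : 0 ≤ C1 / R := by positivity
  set q : ℝ := √((s + 1) * p) with hq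
  have hq0 : 0 ≤ q := Real.sqrt_nonneg _
  have hq2 : q ^ 2 = (s + 1) * p := Real.sq_sqrt (by positivity)
  -- Here 1.45² exceeds 2, while 1.45(1 + 2p) is still below 2, which leaves room for the factor
  -- C1/R in the next step.
  have b1 : √(2 * C2 * h) ≤ C1 * (1.45 * q) := by
    refine Real.sqrt_le_iff.mpr ⟨by positivity, ?_⟩
    have : C2 * h ≤ (p * C1) * ((s + 1) * C1) := mul_le_mul hC2p hh hh0 (by positivity)
    have e : (C1 * (1.45 * q)) ^ 2 = 2.1025 * ((p * C1) * ((s + 1) * C1)) := by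
      rw [mul_pow, mul_pow, hq2]; ring
    rw [e]
    have : 0 ≤ (p * C1) * ((s + 1) * C1) := by positivity
    linarith
  have b2 : (C1 * τ + √(2 * C2 * h)) / R ≤ τ + 2 * p + 2 * q := by
    calc (C1 * τ + √(2 * C2 * h)) / R ≤ (C1 * τ + C1 * (1.45 * q)) / R := by gcongr
      _ = (C1 / R) * (τ + 1.45 * q) := by ring
      _ ≤ (1 + 2 * p) * (τ + 1.45 * q) := by gcongr
      _ ≤ _ := by nlinarith [mul_nonneg hp0 hq0, mul_nonneg hp0 hτ0]
  have b3 : √(s * (C1 * p ^ 2 * h / R ^ 2 + C2 / R)) ≤ 2 * q := by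
    refine Real.sqrt_le_iff.mpr ⟨by positivity, ?_⟩
    have e : (2 * q) ^ 2 = 4 * ((s + 1) * p) := by rw [mul_pow, hq2]; ring
    rw [e]
    have f1 : C1 * p ^ 2 * h / R ^ 2 ≤ (s + 1) * p ^ 2 * (1 + 2 * p) ^ 2 := by
      calc C1 * p ^ 2 * h / R ^ 2 ≤ C1 * p ^ 2 * ((s + 1) * C1) / R ^ 2 := by gcongr
        _ = (s + 1) * p ^ 2 * (C1 / R) ^ 2 := by field_simp
        _ ≤ _ := by gcongr
    have f2 : C2 / R ≤ p * (1 + 2 * p) := by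
      calc C2 / R ≤ p * C1 / R := by gcongr
        _ = p * (C1 / R) := by ring
        _ ≤ _ := by gcongr
    have f3 : (s + 1) * p ^ 2 * (1 + 2 * p) ^ 2 + p * (1 + 2 * p) ≤ 2 * p := by
      have u1 : (s + 1) * p ≤ 0.02 := by
        have hss : (s : ℝ) * p ≤ s ^ 2 * p :=
          mul_le_mul_of_nonneg_right (by nlinarith only [hs0]) hp0
        linarith only [hss, hp100, hpsm]
      have u2 : (1 + 2 * p) ^ 2 ≤ 2 := by nlinarith only [hp0, hpsm]
      have u3 : (s + 1) * p ^ 2 * (1 + 2 * p) ^ 2 ≤ 0.02 * p * 2 := by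
        refine mul_le_mul ?_ u2 (sq_nonneg _) (by positivity)
        calc ((s : ℝ) + 1) * p ^ 2 = ((s + 1) * p) * p := by ring
          _ ≤ 0.02 * p := mul_le_mul_of_nonneg_right u1 hp0
      nlinarith only [u3, mul_le_mul_of_nonneg_right hpsm hp0, hp0]
    have : (s : ℝ) * (C1 * p ^ 2 * h / R ^ 2 + C2 / R) ≤ s * (2 * p) := by
      gcongr; linarith only [f1, f2, f3]
    linarith only [this, hp0, mul_nonneg (by linarith only [hs0] : (0 : ℝ) ≤ s) hp0]
  linarith only [b2, b3]

/-- The main terms cancel because λ - sλ/(s+1) = λ/(s+1). With q = √((s+1)p), the root in τ is at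
least 6q since 40 > 36, which covers the spectral loss 4q and leaves 2q. The linear terms exceed
(s²+4s)p by (5s+6)p, and 10sp ≤ q follows from 100s²p ≤ 1. -/
theorem error_budget {s lam τ p : ℝ} (hs : 1 ≤ s) (hp : 0 < p) (hp100 : 100 * s ^ 2 * p ≤ 1)
    (hτ : τ = lam / (s + 1) - √(40 * (s + 1) * p) - (s ^ 2 + 4 * s) * p) :
    s * lam / (s + 1) + 6 * s * p
      < (s - (s ^ 2 + s) * p) + (lam - s - 2 * s * p) - (τ + 2 * p + 4 * √((s + 1) * p)) - 4 * p := by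
  set q : ℝ := √((s + 1) * p) with hq
  have hq2 : q ^ 2 = (s + 1) * p := Real.sq_sqrt (by positivity)
  have hqpos : 0 < q := Real.sqrt_pos.mpr (by positivity)
  have h40 : 6 * q ≤ √(40 * (s + 1) * p) := by
    refine Real.le_sqrt_of_sq_le ?_
    rw [mul_pow, hq2]
    nlinarith [mul_pos (by linarith : 0 < s + 1) hp]
  have h10 : 10 * s * p ≤ q := by
    refine Real.le_sqrt_of_sq_le ?_
    have : (10 * s * p) ^ 2 = (100 * s ^ 2 * p) * p := by ring
    rw [this]
    nlinarith
  have e : lam - s * lam / (s + 1) = lam / (s + 1) := by field_simp; ring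
  have : 0 < s * p := by positivity
  nlinarith

theorem second_level_choose_le (hk : 2 ≤ k) (hn : 100 * k ≤ n) :
    ((n - k - 2).choose (k - 2) : ℝ) ≤ (n - k - 1).choose (k - 1) * (2 * (k / n)) := by
  have h1 := choose_mul_eq (n - k - 1) (k - 1) (by omega) (by omega)
  rw [show n - k - 1 - 1 = n - k - 2 by omega, show k - 1 - 1 = k - 2 by omega] at h1
  have c2 : ((k - 1 : ℕ) : ℝ) = k - 1 := by rw [Nat.cast_sub (by omega)]; simp
  have c3 : ((n - k - 1 : ℕ) : ℝ) = n - k - 1 := by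
    rw [Nat.cast_sub (by omega), Nat.cast_sub (by omega)]; simp
  rw [c2, c3] at h1
  have hk0 : (2 : ℝ) ≤ k := by exact_mod_cast hk
  have hn' : (100 : ℝ) * k ≤ n := by exact_mod_cast hn
  have h2 : ((k : ℝ) - 1) ≤ (n - k - 1) * (2 * (k / n)) := by
    have : ((n : ℝ) - k - 1) * (2 * (k / n)) = (2 * k * (n - k - 1)) / n := by ring
    rw [this, le_div_iff₀ (by linarith)]
    nlinarith only [hk0, hn']
  have h3 : ((n : ℝ) - k - 1) * (n - k - 2).choose (k - 2)
      ≤ (n - k - 1) * ((n - k - 1).choose (k - 1) * (2 * (k / n))) := by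
    rw [h1]
    calc ((k : ℝ) - 1) * (n - k - 1).choose (k - 1)
        ≤ ((n - k - 1) * (2 * (k / n))) * (n - k - 1).choose (k - 1) :=
          mul_le_mul_of_nonneg_right h2 (Nat.cast_nonneg _)
      _ = _ := by ring
  exact le_of_mul_le_mul_left h3 (by linarith)

theorem heavy_points_of_one_lt (hk : 2 ≤ k) (hs : 1 ≤ s) (hn : 100 * s ^ 2 * k ≤ n)
    (lam : ℝ) (F : Finset (KSet n k)) (hsize : HasSizeParameter s lam F)
    (hstars : ¬ IsUnionOfStars s F)
    (hmin : ∀ G : Finset (KSet n k), HasSizeParameter s lam G → ¬ IsUnionOfStars s G →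
      familyMaxDegree F ≤ familyMaxDegree G) (τ : ℝ)
    (hτ : τ = lam / ((s : ℝ) + 1) - √(40 * ((s : ℝ) + 1) * (k / n))
      - ((s : ℝ) ^ 2 + 4 * s) * (k / n)) :
    ∃ T : Finset (Fin n), s + 1 ≤ T.card ∧ ∀ x ∈ T,
      ((n - 1).choose (k - 1) : ℝ) * τ ≤ pointDegree (underlying F) x := by
  obtain ⟨g1, g2, -, g4⟩ := mul_le_two_mul_of_hundred hk hs hn
  obtain ⟨l1, l2, hcard⟩ := hsize
  have hN : (0 : ℝ) < ((n - 1).choose (k - 1) : ℝ) := by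
    exact_mod_cast Nat.choose_pos (by omega)
  have hL : (0 : ℝ) < ((n - k - 1).choose (k - 1) : ℝ) := by
    exact_mod_cast Nat.choose_pos (by omega)
  have hk0 : (2 : ℝ) ≤ k := by exact_mod_cast hk
  have hs0 : (1 : ℝ) ≤ s := by exact_mod_cast hs
  have g1' : (100 : ℝ) * k ≤ n := by exact_mod_cast g1
  have hn0 : (0 : ℝ) < n := by linarith
  have hp0 : (0 : ℝ) < k / n := by positivity
  -- For τ ≤ 0 every point qualifies. Otherwise τ lies in (0, 1], as the error estimates require.
  rcases le_or_gt τ 0 with hτ0 | hτ0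
  · refine ⟨univ, by rw [card_univ, Fintype.card_fin]; omega, fun x _ => ?_⟩
    exact (mul_nonpos_of_nonneg_of_nonpos hN.le hτ0).trans (by rw [pointDegree]; positivity)
  by_contra hcon
  push Not at hcon
  have hτ1 : τ ≤ 1 := by
    have h1 : lam / ((s : ℝ) + 1) ≤ 1 := by rw [div_le_one (by linarith)]; exact l2
    have h2 : 0 ≤ √(40 * ((s : ℝ) + 1) * (k / n)) := Real.sqrt_nonneg _
    have h3 : 0 ≤ ((s : ℝ) ^ 2 + 4 * s) * (k / n) := by positivity
    linarith
  -- the heavy points lie in a set `T` of size `s`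
  set T₀ : Finset (Fin n) := univ.filter
    (fun x => ((n - 1).choose (k - 1) : ℝ) * τ ≤ pointDegree (underlying F) x) with hT₀
  have hT₀c : T₀.card ≤ s := by
    by_contra h
    obtain ⟨x, hx, hlt⟩ := hcon T₀ (by omega)
    exact absurd (mem_filter.mp hx).2 (not_le.mpr hlt)
  obtain ⟨T, hT₀T, -, hTc⟩ := exists_subsuperset_card_eq (subset_univ T₀) hT₀c
    (by rw [card_univ, Fintype.card_fin]; omega)
  have hFl := underlying_subset F
  set H : Finset (Finset (Fin n)) := (underlying F).filter (fun A => Disjoint A T) with hH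
  set U : Finset (Finset (Fin n)) := (layer (Fin n) k).filter (fun A => ¬ Disjoint A T) with hU
  set M : Finset (Finset (Fin n)) := U \ underlying F with hM
  have hUc : (U.card : ℝ) = n.choose k - (n - s).choose k := by
    rw [hU, card_layer_hits, hTc, Fintype.card_fin, Nat.cast_sub]
    exact Nat.choose_le_choose _ (Nat.sub_le _ _)
  have hHM : (H.card : ℝ) - M.card = (lam - s) * (n - s - 1).choose (k - 1) := by
    have h1 := card_filter_add_card_filter_not (s := underlying F) (fun A => Disjoint A T)
    have h2 : M.card + ((underlying F).filter (fun A => ¬ Disjoint A T)).card = U.card := by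
      have : U ∩ underlying F = (underlying F).filter (fun A => ¬ Disjoint A T) := by
        ext A
        rw [mem_inter, hU, mem_filter, mem_filter]
        exact ⟨fun h => ⟨h.2, h.1.2⟩, fun h => ⟨⟨hFl h.1, h.2⟩, h.1⟩⟩
      rw [← this, hM]
      exact card_sdiff_add_card_inter _ _
    rw [card_underlying] at h1
    have h1R := congrArg (Nat.cast (R := ℝ)) h1
    have h2R := congrArg (Nat.cast (R := ℝ)) h2
    push_cast at h1R h2R
    rw [hUc] at h2R
    rw [hcard] at h1R
    change ((H.card : ℝ)) + _ = _ at h1R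
    linarith
  have hHM0 : M.card ≤ H.card := by
    have : (0 : ℝ) ≤ (lam - s) * (n - s - 1).choose (k - 1) :=
      mul_nonneg (by linarith) (Nat.cast_nonneg _)
    exact_mod_cast (by linarith : (M.card : ℝ) ≤ H.card)
  -- If H were empty, |M| ≤ |H| would empty M as well, and F would be exactly the union of the stars
  -- of T.
  have hHne : H.Nonempty := by
    rw [nonempty_iff_ne_empty]
    intro hemp
    have hM0 : M = ∅ := by
      rw [hemp, card_empty] at hHM0
      exact card_eq_zero.mp (by omega)
    refine hstars (isUnionOfStars_of_underlying_eq hTc ?_)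
    refine subset_antisymm (fun A hA => mem_filter.mpr ⟨hFl hA, fun hd => ?_⟩)
      (sdiff_eq_empty_iff_subset.mp hM0)
    have : A ∈ H := mem_filter.mpr ⟨hA, hd⟩
    rw [hemp] at this
    exact notMem_empty _ this
  have hδ : ∀ x, pointDegree H x ≤ ((n - 1).choose (k - 1) : ℝ) * τ := by
    intro x
    by_cases hx : x ∈ T
    · have : H.filter (fun A => x ∈ A) = ∅ := by
        rw [filter_eq_empty_iff]
        intro A hA hxA
        exact disjoint_left.mp (mem_filter.mp hA).2 hxA hx
      rw [pointDegree, this, card_empty, Nat.cast_zero]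
      positivity
    · have hx0 : x ∉ T₀ := fun h => hx (hT₀T h)
      rw [hT₀, mem_filter, not_and, not_le] at hx0
      refine le_trans ?_ (hx0 (mem_univ _)).le
      rw [pointDegree, pointDegree]
      exact_mod_cast card_le_card (filter_subset_filter _ (filter_subset _ _))
  have hlow := maxDegree_lower_bound (k := k) hk (by rw [Fintype.card_fin]; omega) hFl T
    (familyMaxDegree F : ℝ) (((n - 1).choose (k - 1) : ℝ) * τ)
    (fun A hA => by exact_mod_cast card_disjoint_le_familyMaxDegree (by omega) F hA)
    hH hHne hM hHM0 hδ
  rw [Fintype.card_fin, hTc, hHM] at hlow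
  -- the size of `F`
  have hFub : (F.card : ℝ) ≤ (s + 1) * (n - 1).choose (k - 1) := by
    have h1 := choose_sub_choose_le n s k (by omega) (by omega)
    have h2 : ((n - s - 1).choose (k - 1) : ℝ) ≤ (n - 1).choose (k - 1) := by
      exact_mod_cast Nat.choose_le_choose _ (by omega)
    have h3 : (lam - s) * ((n - s - 1).choose (k - 1) : ℝ) ≤ 1 * (n - 1).choose (k - 1) :=
      mul_le_mul (by linarith) h2 (Nat.cast_nonneg _) zero_le_one
    rw [hcard]
    linarith
  have hHub : (H.card : ℝ) ≤ (s + 1) * (n - 1).choose (k - 1) := by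
    refine le_trans ?_ hFub
    rw [← card_underlying F]
    exact_mod_cast card_le_card (filter_subset _ _)
  have hC1 : coverCount (Fin n) k 1 = (n - 1).choose (k - 1) := by
    rw [coverCount_one k (by omega) (by rw [Fintype.card_fin]; omega), Fintype.card_fin]
  have hC12 : ((n : ℝ) - 1) * coverCount (Fin n) k 2 = (k - 1) * coverCount (Fin n) k 1 := by
    have := coverCount_succ_mul (α := Fin n) k 1 (by omega) (by rw [Fintype.card_fin]; omega)
    rw [Fintype.card_fin] at this
    push_cast at this
    exact this
  have herr := spectral_error_le hk hs hn τ H.card hτ0.le hτ1 (Nat.cast_nonneg _) hHub _ _ hC1 hC12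
  rw [hC1] at herr hC12
  rw [hC1] at hlow
  -- the competing family
  have hm : (s + 1) * (n - 2).choose (n - k) < F.card := by
    have h1 : ((n - 1).choose (k - 1) : ℝ) ≤ F.card := by
      have e1 : (n.choose k : ℝ) - (n - 1).choose k = (n - 1).choose (k - 1) := by
        have e2 : n = (n - 1) + 1 := by omega
        have e3 : k = (k - 1) + 1 := by omega
        have := Nat.choose_succ_succ (n - 1) (k - 1)
        rw [Nat.succ_eq_add_one, Nat.succ_eq_add_one, ← e2, ← e3] at this
        rw [this]; push_cast; ring
      have e2 : ((n - s).choose k : ℝ) ≤ (n - 1).choose k := by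
        exact_mod_cast Nat.choose_le_choose _ (by omega)
      have e3 : 0 ≤ (lam - s) * ((n - s - 1).choose (k - 1) : ℝ) :=
        mul_nonneg (by linarith) (Nat.cast_nonneg _)
      rw [hcard]; linarith
    have h2 : ((s : ℝ) + 1) * coverCount (Fin n) k 2 < (n - 1).choose (k - 1) := by
      have g4' : ((s : ℝ) + 1) * k < n := by exact_mod_cast g4
      have h3 : ((n : ℝ) - 1) * (((s : ℝ) + 1) * coverCount (Fin n) k 2)
          < (n - 1) * (n - 1).choose (k - 1) := by
        calc ((n : ℝ) - 1) * (((s : ℝ) + 1) * coverCount (Fin n) k 2)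
            = (s + 1) * ((n - 1) * coverCount (Fin n) k 2) := by ring
          _ = ((s + 1) * (k - 1)) * (n - 1).choose (k - 1) := by rw [hC12]; ring
          _ < _ := by
            refine mul_lt_mul_of_pos_right ?_ hN
            nlinarith
      exact lt_of_mul_lt_mul_left h3 (by linarith)
    rw [coverCount, Fintype.card_fin] at h2
    exact_mod_cast h2.trans_le h1
  have hm2 : F.card ≤ n.choose k - (n - (s + 1)).choose k := by
    have hpascal : ((n - s).choose k : ℝ)
        = (n - s - 1).choose (k - 1) + (n - s - 1).choose k := by
      have e1 : n - s = (n - s - 1) + 1 := by omega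
      have e2 : k = (k - 1) + 1 := by omega
      have := Nat.choose_succ_succ (n - s - 1) (k - 1)
      rw [Nat.succ_eq_add_one, Nat.succ_eq_add_one, ← e1, ← e2] at this
      exact_mod_cast this
    have h1 : (F.card : ℝ) + (n - s - 1).choose k ≤ n.choose k := by
      have : (lam - s) * ((n - s - 1).choose (k - 1) : ℝ) ≤ 1 * (n - s - 1).choose (k - 1) :=
        mul_le_mul_of_nonneg_right (by linarith) (Nat.cast_nonneg _)
      rw [hcard]; linarith
    have h2 : F.card + (n - s - 1).choose k ≤ n.choose k := by exact_mod_cast h1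
    rw [show n - (s + 1) = n - s - 1 by omega]
    omega
  obtain ⟨G, b, hb2, hbn, hGc, hGs, hGd, hGm⟩ :=
    exists_family_small_maxDegree hk g2 F.card hm hm2
  have hFG := hmin G ⟨l1, l2, by rw [hGc]; exact hcard⟩ hGs
  have hup := maxDegree_upper_estimate hk hs hn lam l1 l2 F.card b (familyMaxDegree F) hb2 hbn
    hcard (hFG.trans hGd) hGm
  have a1 := degree_into_stars_ge hk hs hn
  have a2 := excess_density_ge hk hs hn lam l1 l2
  have a5 := second_level_choose_le hk g1
  have hbud := mul_lt_mul_of_pos_left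
    (error_budget hs0 hp0 (hundred_mul_density hk hs hn) hτ) hL
  have herr' := mul_le_mul_of_nonneg_left herr hL.le
  refine absurd hbud (not_lt.mpr ?_)
  rw [mul_sub, mul_sub, mul_add]
  linarith only [herr', hlow, hup, a1, a2, a5]

/-- For k = 1 stars are single vertices, so F is the union of |F| stars. The size condition gives
|F| ≥ s, and equality would make F a union of s stars; minimality plays no role. -/
theorem heavy_points_of_eq_one (hs : 1 ≤ s) (hn : 100 * s ^ 2 * 1 ≤ n)
    (lam : ℝ) (F : Finset (KSet n 1)) (hsize : HasSizeParameter s lam F)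
    (hstars : ¬ IsUnionOfStars s F) :
    ∃ T : Finset (Fin n), s + 1 ≤ T.card ∧ ∀ x ∈ T, 1 ≤ pointDegree (underlying F) x := by
  obtain ⟨l1, -, hcard⟩ := hsize
  have hsn : s ≤ n := by nlinarith
  have hFs : s ≤ F.card := by
    simp only [Nat.choose_one_right, Nat.sub_self, Nat.choose_zero_right] at hcard
    rw [Nat.cast_sub hsn] at hcard
    have : (s : ℝ) ≤ F.card := by push_cast at hcard; linarith
    exact_mod_cast this
  set T : Finset (Fin n) := univ.filter (fun x => {x} ∈ underlying F) with hT
  have hsub : (layer (Fin n) 1).filter (fun A => ¬ Disjoint A T) = underlying F := by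
    ext A
    rw [mem_filter, mem_layer, card_eq_one]
    constructor
    · rintro ⟨⟨x, rfl⟩, h⟩
      rw [disjoint_singleton_left, not_not, hT, mem_filter] at h
      exact h.2
    · intro hA
      obtain ⟨x, rfl⟩ := card_eq_one.mp (mem_layer.mp (underlying_subset F hA))
      refine ⟨⟨x, rfl⟩, ?_⟩
      rw [disjoint_singleton_left, not_not, hT, mem_filter]
      exact ⟨mem_univ _, hA⟩
  have hTF : T.card = F.card := by
    rw [← card_underlying, ← hsub, card_layer_hits, Fintype.card_fin, Nat.choose_one_right,
      Nat.choose_one_right]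
    have := card_le_univ T
    rw [Fintype.card_fin] at this
    omega
  refine ⟨T, ?_, fun x hx => ?_⟩
  · by_contra h
    exact hstars (isUnionOfStars_of_underlying_eq (S := T) (by omega) hsub.symm)
  · rw [pointDegree]
    exact_mod_cast card_pos.mpr ⟨{x}, mem_filter.mpr ⟨(mem_filter.mp hx).2, mem_singleton_self x⟩⟩

end Assembly

theorem mainTheorem5 (n k s : ℕ) (hk : 1 ≤ k) (hs : 1 ≤ s) (hn : 100 * s ^ 2 * k ≤ n)
    (lam : ℝ) (F : Finset (KSet n k))
    (hsize : HasSizeParameter s lam F)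
    (hstars : ¬ IsUnionOfStars s F)
    (hmin : ∀ G : Finset (KSet n k), HasSizeParameter s lam G → ¬ IsUnionOfStars s G →
      familyMaxDegree F ≤ familyMaxDegree G)
    (p : ℝ) (hp : p = (k : ℝ) / (n : ℝ)) :
    ∃ T : Finset (Fin n), s + 1 ≤ T.card ∧ ∀ x ∈ T,
      ((n - 1).choose (k - 1) : ℝ) *
          (lam / ((s : ℝ) + 1) - Real.sqrt (40 * ((s : ℝ) + 1) * p) - ((s : ℝ) ^ 2 + 4 * s) * p)
        ≤ ((familyTrace F {x} {x}).card : ℝ) := by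
  subst hp
  simp only [card_familyTrace_singleton]
  -- For k = 1 the binomial factor is 1 and the bracket is at most λ/(s+1) ≤ 1, so degree one
  -- suffices.
  rcases hk.eq_or_lt with rfl | hk2
  · obtain ⟨T, hT, hx⟩ := heavy_points_of_eq_one hs hn lam F hsize hstars
    refine ⟨T, hT, fun x hxT => le_trans ?_ (hx x hxT)⟩
    have h1 : lam / ((s : ℝ) + 1) ≤ 1 := by
      rw [div_le_one (by positivity)]; exact hsize.2.1
    have h2 : 0 ≤ √(40 * ((s : ℝ) + 1) * (((1 : ℕ) : ℝ) / n)) := Real.sqrt_nonneg _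
    have h3 : 0 ≤ ((s : ℝ) ^ 2 + 4 * s) * (((1 : ℕ) : ℝ) / n) := by positivity
    rw [Nat.sub_self, Nat.choose_zero_right, Nat.cast_one, one_mul]
    push_cast at h2 h3 ⊢
    linarith
  · exact heavy_points_of_one_lt hk2 hs hn lam F hsize hstars hmin _ rfl
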